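/- Let $S_{n+1}$ be generated by the adjacent transpositions $s_1,\dots,s_n$. The heap of a reduced word $\mathsf w=\mathsf w_1\cdots\mathsf w_l$ is the set of positions $\{1,\dots,l\}$, position $p$ labeled by $\mathsf w_p$ (position $p$ lies in column $i$ if $\mathsf w_p=s_i$), ordered by the transitive closure of the relation: $p\prec q$ if $p<q$ and $\mathsf w_p,\mathsf w_q$ do not commute. A permutation is fully commutative if any two of its reduced words are related by moves $s_is_j\mapsto s_js_i$ with $|i-j|\ge 2$; it then has a unique heap up to isomorphism. A permutation in $S_{n+1}$ is connected if $n\ge 1$ and every $s_1,\dots,s_n$ occurs in its reduced words; columns $2,\dots,n-1$ are then its internal columns. A permutation $w\in S_{n+1}$ heap-contains $h\in S_{k+1}$ if there are reduced words $\mathsf w$ of $w$ and $\mathsf h$ of $h$ and a strictly increasing map $f:\{1,\dots,k\}\to\{1,\dots,n\}$ with $(s_is_j)^m=1\iff(s_{f(i)}s_{f(j)})^m=1$ for all $i,j$ and $m\in\{2,3\}$, such that the heap of $f(\mathsf h)$ (each $s_i$ replaced by $s_{f(i)}$) is isomorphic to a convex labeled subposet of the heap of $\mathsf w$; otherwise $w$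 heap-avoids $h$. Let $k\ge 1$, and let $h\in S_{k+3}$ be a connected fully commutative permutation whose heap has at least two entries in each of the internal columns $2,\dots,k+1$. A minimal diamond of the heap of $h$ consists of two entries $x<y$ of one column $i$ with no entry of column $i$ strictly between them, together with an entry of column $i-1$ and an entry of column $i+1$, both strictly between $x$ and $y$; its edges are the four pairs formed by one of these two entries and one of $x,y$. Let $g\in S_{k+1}$ be the diamond reduction of $h$: the permutation whose heap has one entry in column $i-1$ for each minimal diamond of the heap of $h$ centered in column $i$, ordered by the transitive closure of the relation that one diamond lies below another in the heap of $h$ and shares an edge with it. Put $$F(x)=\sum_{n\ge0}|\{w\in S_{n+1}: w \text{ avoids } [321] \text{ and heap-avoids } h\}|\,x^n,$$ $$G(x)=\sum_{n\ge0}|\{w\in S_{n+1}: w \text{ avoids } [321] \text{ and heap-avoids } g\}|\,x^n,$$ $$G_c(x)=\sum_{n\ge0}|\{w\in S_{n+1}: w \text{ is connected, avoids } [321] \text{ and heap-avoids } g\}|\,x^n.$$ Then, as formal power series, $$F(x)=\frac{1-x-xG_c(x)}{1-3x+x^2+(x^2-x)G_c(x)}=\frac{1}{1-2x-x^2G(x)}.$$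 -/

import Mathlib

namespace HeapPattern

/-! ### Permutations, words and full commutativity

`Equiv.Perm (Fin (n + 1))` is the symmetric group on `n + 1` letters, generated by the adjacent
transpositions `s i`, `i : Fin n`.  Everything is indexed from `0`. -/

/-- The adjacent transposition exchanging `i` and `i + 1`. -/
def s {n : ℕ} (i : Fin n) : Equiv.Perm (Fin (n + 1)) :=
  Equiv.swap i.castSucc i.succ

/-- The permutation expressed by a word in the generators. -/
def wordProd {n : ℕ} (u : List (Fin n)) : Equiv.Perm (Fin (n + 1)) :=
  (u.map s).prod

/-- `u` is a reduced expression for `w`: an expression with the least number of factors. -/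
def IsReducedWord {n : ℕ} (w : Equiv.Perm (Fin (n + 1))) (u : List (Fin n)) : Prop :=
  wordProd u = w ∧ ∀ v : List (Fin n), wordProd v = w → u.length ≤ v.length

/-- The indices of two generators differ by exactly one; equivalently, the generators do not
commute. -/
def Adjacent {n : ℕ} (i j : Fin n) : Prop :=
  (i : ℕ) + 1 = j ∨ (j : ℕ) + 1 = i

/-- A commuting move `s i * s j ↦ s j * s i` with `|i - j| ≥ 2` inside a word. -/
def CommutingMove {n : ℕ} (u v : List (Fin n)) : Prop :=
  ∃ (a b : List (Fin n)) (i j : Fin n), ((i : ℕ) + 2 ≤ j ∨ (j : ℕ) + 2 ≤ i) ∧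
    u = a ++ i :: j :: b ∧ v = a ++ j :: i :: b

/-- The reduced expressions of `w` form a single commutativity class. -/
def FullyCommutative {n : ℕ} (w : Equiv.Perm (Fin (n + 1))) : Prop :=
  ∀ u v : List (Fin n), IsReducedWord w u → IsReducedWord w v →
    Relation.ReflTransGen CommutingMove u v

/-- The generators (by index) that occur in reduced expressions of `w`. -/
def supp {n : ℕ} (w : Equiv.Perm (Fin (n + 1))) : Set (Fin n) :=
  {i | ∃ u : List (Fin n), IsReducedWord w u ∧ i ∈ u}

/-- A connected permutation: there is at least one generator, and every one of the columns
`0, …, n - 1` supports `w`. -/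
def Connected {n : ℕ} (w : Equiv.Perm (Fin (n + 1))) : Prop :=
  (supp w).Nonempty ∧ supp w = Set.univ

/-- `w` contains `p` as a 1-line pattern. -/
def ContainsPattern {n k : ℕ} (w : Equiv.Perm (Fin n)) (p : Equiv.Perm (Fin k)) : Prop :=
  ∃ f : Fin k → Fin n, StrictMono f ∧ ∀ a b : Fin k, a < b → (w (f a) < w (f b) ↔ p a < p b)

/-- `w` avoids the 1-line pattern `[321]`. -/
def Avoids321 {n : ℕ} (w : Equiv.Perm (Fin n)) : Prop :=
  ¬ ContainsPattern w (Fin.revPerm : Equiv.Perm (Fin 3))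

/-! ### Heaps and heap containment -/

/-- The strict order of the heap of the word `u`, on the positions of `u`; the label (column) of
the position `p` is `u.get p`. -/
def heapLT {n : ℕ} (u : List (Fin n)) : Fin u.length → Fin u.length → Prop :=
  Relation.TransGen fun p q => p < q ∧ Adjacent (u.get p) (u.get q)

/-- The heap of `v` is contained in the heap of `u` as a convex labeled subposet. -/
def ConvexSubheap {n : ℕ} (v u : List (Fin n)) : Prop :=
  ∃ φ : Fin v.length → Fin u.length, Function.Injective φ ∧
    (∀ p, u.get (φ p) = v.get p) ∧
    (∀ p q, heapLT u (φ p) (φ q) ↔ heapLT v p q) ∧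
    ∀ p q y, heapLT u (φ p) y → heapLT u y (φ q) → y ∈ Set.range φ

/-- Orientation preserving Coxeter embeddings of the generators. -/
def IsCoxeterEmbedding {k n : ℕ} (f : Fin k → Fin n) : Prop :=
  StrictMono f ∧ ∀ i j : Fin k, ∀ m ∈ ({2, 3} : Set ℕ),
    ((s i * s j) ^ m = 1 ↔ (s (f i) * s (f j)) ^ m = 1)

/-- `w` heap-contains `h`. -/
def HeapContains {n k : ℕ} (w : Equiv.Perm (Fin (n + 1))) (h : Equiv.Perm (Fin (k + 1))) : Prop :=
  ∃ (u : List (Fin n)) (v : List (Fin k)) (f : Fin k → Fin n),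
    IsReducedWord w u ∧ IsReducedWord h v ∧ IsCoxeterEmbedding f ∧ ConvexSubheap (v.map f) u

/-- `w` heap-avoids `h`. -/
def HeapAvoids {n k : ℕ} (w : Equiv.Perm (Fin (n + 1))) (h : Equiv.Perm (Fin (k + 1))) : Prop :=
  ¬ HeapContains w h

/-! ### Diamond reduction -/

/-- Every internal column of the heap of `h` (every column except the first and the last one,
for a connected `h`) has at least two entries. -/
def TwoInInternalColumns {k : ℕ} (h : Equiv.Perm (Fin (k + 1))) : Prop :=
  ∀ u : List (Fin k), IsReducedWord h u →
    ∀ i : Fin k, 0 < (i : ℕ) → (i : ℕ) + 1 < k → 2 ≤ u.count i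

/-- A minimal diamond in the heap of `u`: a minimal pair `bot`, `top` of entries in one column,
together with its distinct resolution, an entry `left` of the previous column and an entry `right`
of the next column, both strictly between `bot` and `top`. -/
structure MinimalDiamond {n : ℕ} (u : List (Fin n)) where
  bot : Fin u.length
  left : Fin u.length
  right : Fin u.length
  top : Fin u.length
  same_column : u.get bot = u.get top
  bot_lt_top : heapLT u bot top
  minimal : ∀ z, heapLT u bot z → heapLT u z top → u.get z ≠ u.get bot
  left_column : (u.get left : ℕ) + 1 = u.get bot
  right_column : (u.get right : ℕ) = u.get bot + 1
  bot_lt_left : heapLT u bot left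
  left_lt_top : heapLT u left top
  bot_lt_right : heapLT u bot right
  right_lt_top : heapLT u right top

namespace MinimalDiamond

variable {n : ℕ} {u : List (Fin n)}

/-- The column in which the minimal diamond is centered. -/
def column (d : MinimalDiamond u) : Fin n := u.get d.bot

/-- The four edges of a minimal diamond, each written as (lower entry, upper entry). -/
def edges (d : MinimalDiamond u) : Set (Fin u.length × Fin u.length) :=
  {(d.bot, d.left), (d.bot, d.right), (d.left, d.top), (d.right, d.top)}

/-- `d` and `d'` share an edge and `d` lies below `d'` in the heap. -/
def EdgeBelow (d d' : MinimalDiamond u) : Prop :=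
  (d.edges ∩ d'.edges).Nonempty ∧ heapLT u d.bot d'.bot

end MinimalDiamond

/-- `g` is the diamond reduction of `h`: the heap of `g` has one entry for each minimal diamond of
the heap of `h`, in the column of the center of the diamond (the internal columns
`1, …, k` of `h` become the columns `0, …, k - 1` of `g`), ordered by the transitive closure of
the relation `EdgeBelow`. -/
def IsDiamondReduction {k : ℕ} (h : Equiv.Perm (Fin (k + 2 + 1))) (g : Equiv.Perm (Fin (k + 1))) :
    Prop :=
  ∃ (u : List (Fin (k + 2))) (v : List (Fin k)), IsReducedWord h u ∧ IsReducedWord g v ∧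
    ∃ e : Fin v.length ≃ MinimalDiamond u,
      (∀ p, ((e p).column : ℕ) = (v.get p : ℕ) + 1) ∧
      ∀ p q, heapLT v p q ↔ Relation.TransGen MinimalDiamond.EdgeBelow (e p) (e q)

/-! ### Generating functions -/

/-- The generating function of the `[321]`-avoiding permutations in `S_{n+1}` that heap-avoid
`h`. -/
noncomputable def genFun {k : ℕ} (h : Equiv.Perm (Fin (k + 1))) : PowerSeries ℚ :=
  PowerSeries.mk fun n =>
    (Nat.card {w : Equiv.Perm (Fin (n + 1)) // Avoids321 w ∧ HeapAvoids w h} : ℚ)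

/-- The generating function of the connected `[321]`-avoiding permutations in `S_{n+1}` that
heap-avoid `h`. -/
noncomputable def genFunConnected {k : ℕ} (h : Equiv.Perm (Fin (k + 1))) : PowerSeries ℚ :=
  PowerSeries.mk fun n =>
    (Nat.card {w : Equiv.Perm (Fin (n + 1)) // Avoids321 w ∧ HeapAvoids w h ∧ Connected w} : ℚ)

end HeapPattern

/-!
Write `s i` as a letter in column `i`.  In every reduced word of a permutation that avoids `321` (or
is fully commutative) there is no braid factor `i j i`, and this forces the word to be alternating:
between two occurrences of a letter both neighbouring letters occur (`BraidFree.alternating`).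
Conversely, in the product of an alternating word every element only moves up or only moves down, so
that the product avoids `321` (`Alternating.avoids321`).

The heap of an alternating word is the set of lattice points between two lattice paths, ordered by
the relations `(j, z) < (j ± 1, z + 1)` (`Alternating.isHeapShape`).  The steps of the upper path
record the excedances of the permutation, the steps of the lower path record the excedance values.
Since a permutation avoiding `321` is determined by these two sets, and they can be prescribed
subject to a ballot condition, these permutations correspond to the pairs of paths of `GoodFrom 0`,
which are bicolored Motzkin paths (`steps_injOn`, `exists_steps_eq`).

For a connected `h`, heap containment means that some translate of the region of `h` lies inside of
the region of `w` (`heapContains_iff`).  A minimal diamond is given by two consecutive points of a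
column, so that diamond reduction moves the two paths of `h` towards each other by one and drops the
outermost columns (`IsHeapShape.diamondReduction`).  Therefore `w` contains `h` if and only if the
region of `w`, reduced in the same way, contains the region of `g`
(`heapContains_iff_fits_of_isDiamondReduction`).  The reduced region is nonempty only over the
excursions of the Motzkin path of `w`, and reduction turns the interior of an excursion into the
path of an arbitrary permutation avoiding `321`.

Cutting the Motzkin path at its first step yields `F = 1 + 2 x F + x² G F`
(`listGenFun_avoidingPaths_neg_two`), and cutting a heap at its first empty column yields
`G = (1 + G_c) (1 + x G)` (`listGenFun_avoidingPaths_zero`).  Both formulas follow from these two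
equations.
-/

namespace HeapPattern

/-! ### Words in the adjacent transpositions -/

theorem s_val {n : ℕ} (i : Fin n) (x : Fin (n + 1)) :
    (s i x : ℕ) = if (x : ℕ) = i then (i : ℕ) + 1 else if (x : ℕ) = i + 1 then (i : ℕ) else x := by
  unfold s
  rw [Equiv.swap_apply_def]
  simp only [Fin.ext_iff, Fin.val_castSucc, Fin.val_succ]
  split_ifs <;> simp_all

@[simp] theorem s_castSucc {n : ℕ} (i : Fin n) : s i i.castSucc = i.succ :=
  Equiv.swap_apply_left _ _

@[simp] theorem s_succ {n : ℕ} (i : Fin n) : s i i.succ = i.castSucc :=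
  Equiv.swap_apply_right _ _

theorem s_of_ne {n : ℕ} {i : Fin n} {x : Fin (n + 1)} (h₁ : (i : ℕ) ≠ x) (h₂ : (i : ℕ) + 1 ≠ x) :
    s i x = x := by
  apply Fin.ext
  rw [s_val, if_neg (Ne.symm h₁), if_neg (Ne.symm h₂)]

@[simp] theorem s_mul_self {n : ℕ} (i : Fin n) : s i * s i = 1 :=
  Equiv.swap_mul_self _ _

@[simp] theorem s_inv {n : ℕ} (i : Fin n) : (s i)⁻¹ = s i :=
  Equiv.swap_inv _ _

theorem s_commute {n : ℕ} {i j : Fin n} (h : ¬ Adjacent i j) : Commute (s i) (s j) := by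
  unfold Adjacent at h
  ext x
  simp only [Equiv.Perm.mul_apply, s_val]
  split_ifs <;> omega

theorem s_braid {n : ℕ} {i j : Fin n} (h : Adjacent i j) :
    s i * (s j * s i) = s j * (s i * s j) := by
  have key : ∀ i j : Fin n, (i : ℕ) + 1 = j → s i * (s j * s i) = s j * (s i * s j) := by
    intro i j hij
    have hj : j.castSucc = i.succ := Fin.ext (by simp [hij])
    have f₁ : s j i.castSucc = i.castSucc := s_of_ne (by simp; omega) (by simp; omega)
    have f₂ : s i j.succ = j.succ := s_of_ne (by simp; omega) (by simp; omega)
    have f₃ : s j i.succ = j.succ := by rw [← hj, s_castSucc]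
    have c₁ : s i * s j * (s i)⁻¹ = Equiv.swap i.castSucc j.succ := by
      rw [show s j = Equiv.swap j.castSucc j.succ from rfl, ← Equiv.swap_apply_apply, f₂, hj,
        s_succ]
    have c₂ : s j * s i * (s j)⁻¹ = Equiv.swap i.castSucc j.succ := by
      rw [show s i = Equiv.swap i.castSucc i.succ from rfl, ← Equiv.swap_apply_apply, f₁, f₃]
    rw [s_inv] at c₁ c₂
    rw [← mul_assoc, c₁, ← mul_assoc, c₂]
  rcases h with h | h
  · exact key i j h
  · exact (key j i h).symm

theorem Adjacent.symm {n : ℕ} {i j : Fin n} (h : Adjacent i j) : Adjacent j i :=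
  Or.symm h

@[simp] theorem wordProd_nil {n : ℕ} : wordProd ([] : List (Fin n)) = 1 := rfl

@[simp] theorem wordProd_cons {n : ℕ} (i : Fin n) (u : List (Fin n)) :
    wordProd (i :: u) = s i * wordProd u := by
  simp [wordProd]

@[simp] theorem wordProd_append {n : ℕ} (u v : List (Fin n)) :
    wordProd (u ++ v) = wordProd u * wordProd v := by
  simp [wordProd]

@[simp] theorem wordProd_reverse {n : ℕ} (u : List (Fin n)) :
    wordProd u.reverse = (wordProd u)⁻¹ := by
  induction u with
  | nil => simp
  | cons i u ih => simp [ih]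

theorem apply_inv {α : Type*} (f : Equiv.Perm α) (x : α) : f (f⁻¹ x) = x :=
  f.apply_symm_apply x

theorem commute_wordProd {n : ℕ} {x : Fin n} {b : List (Fin n)} (h : ∀ y ∈ b, ¬ Adjacent x y) :
    Commute (s x) (wordProd b) := by
  induction b with
  | nil => simp
  | cons y b ih =>
    rw [wordProd_cons]
    exact (s_commute (h y (by simp))).mul_right (ih fun z hz => h z (by simp [hz]))

theorem IsReducedWord.of_wordProd_eq {n : ℕ} {w : Equiv.Perm (Fin (n + 1))} {u v : List (Fin n)}
    (hu : IsReducedWord w u) (hv : wordProd v = wordProd u) (hl : v.length = u.length) :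
    IsReducedWord w v :=
  ⟨hv.trans hu.1, fun t ht => hl ▸ hu.2 t ht⟩

theorem IsReducedWord.reverse {n : ℕ} {w : Equiv.Perm (Fin (n + 1))} {u : List (Fin n)}
    (hu : IsReducedWord w u) : IsReducedWord w⁻¹ u.reverse := by
  refine ⟨by rw [wordProd_reverse, hu.1], fun v hv => ?_⟩
  have := hu.2 v.reverse (by rw [wordProd_reverse, hv, inv_inv])
  simpa using this

/-- If the product of a word inverts the pair `p < q`, then some letter of the word exchanges the
images of `p` and `q`. -/
theorem exists_split_of_inversion {n : ℕ} (b : List (Fin n)) {p q : Fin (n + 1)} (hpq : p < q)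
    (h : wordProd b q < wordProd b p) :
    ∃ b₁ j b₂, b = b₁ ++ j :: b₂ ∧ wordProd b₂ p = j.castSucc ∧ wordProd b₂ q = j.succ := by
  induction b with
  | nil => exact absurd h (by simpa using hpq.le)
  | cons j b ih =>
    by_cases hb : wordProd b q < wordProd b p
    · obtain ⟨b₁, i, b₂, rfl, h₁, h₂⟩ := ih hb
      exact ⟨j :: b₁, i, b₂, rfl, h₁, h₂⟩
    · refine ⟨[], j, b, rfl, ?_⟩
      have hne : (wordProd b p : ℕ) ≠ wordProd b q := fun h' =>
        hpq.ne ((wordProd b).injective (Fin.ext h'))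
      simp only [wordProd_cons, Equiv.Perm.mul_apply, Fin.lt_def, s_val] at h hb
      simp only [Fin.ext_iff, Fin.val_castSucc, Fin.val_succ]
      split_ifs at h <;> omega

/-- A letter of a reduced word exchanges two values that no later factor has inverted. -/
theorem IsReducedWord.inv_lt_inv {n : ℕ} {w : Equiv.Perm (Fin (n + 1))} {a b : List (Fin n)}
    {i : Fin n} (hu : IsReducedWord w (a ++ i :: b)) :
    (wordProd b)⁻¹ i.castSucc < (wordProd b)⁻¹ i.succ := by
  by_contra hcon
  have hlt : (wordProd b)⁻¹ i.succ < (wordProd b)⁻¹ i.castSucc := by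
    refine lt_of_le_of_ne (not_lt.1 hcon) fun h => ?_
    have := congrArg Fin.val ((wordProd b)⁻¹.injective h)
    simp at this
  obtain ⟨b₁, j, b₂, rfl, h₁, h₂⟩ := exists_split_of_inversion b hlt (by
    rw [apply_inv, apply_inv]; exact Fin.castSucc_lt_succ)
  have e₁ : wordProd b₁ j.succ = i.succ := by
    have := apply_inv (wordProd (b₁ ++ j :: b₂)) i.succ
    rw [wordProd_append, wordProd_cons, Equiv.Perm.mul_apply, Equiv.Perm.mul_apply] at this
    rw [wordProd_append, wordProd_cons] at h₁
    rwa [h₁, s_castSucc] at this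
  have e₂ : wordProd b₁ j.castSucc = i.castSucc := by
    have := apply_inv (wordProd (b₁ ++ j :: b₂)) i.castSucc
    rw [wordProd_append, wordProd_cons, Equiv.Perm.mul_apply, Equiv.Perm.mul_apply] at this
    rw [wordProd_append, wordProd_cons] at h₂
    rwa [h₂, s_succ] at this
  have hconj : s i * wordProd b₁ = wordProd b₁ * s j := by
    have := Equiv.mul_swap_eq_swap_mul (wordProd b₁) j.castSucc j.succ
    rw [e₁, e₂] at this
    exact this.symm
  have hw : wordProd (a ++ (b₁ ++ b₂)) = w := by
    rw [← hu.1]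
    simp only [wordProd_append, wordProd_cons]
    rw [← mul_assoc (s i), hconj, mul_assoc (wordProd b₁), ← mul_assoc (s j), s_mul_self, one_mul]
  have := hu.2 _ hw
  simp at this

/-- The mirror image of `IsReducedWord.inv_lt_inv`, about the factors to the left of the letter. -/
theorem IsReducedWord.lt {n : ℕ} {w : Equiv.Perm (Fin (n + 1))} {a b : List (Fin n)}
    {i : Fin n} (hu : IsReducedWord w (a ++ i :: b)) :
    wordProd a i.castSucc < wordProd a i.succ := by
  have h := hu.reverse
  rw [List.reverse_append, List.reverse_cons, List.append_assoc, List.singleton_append] at h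
  simpa using h.inv_lt_inv

/-! ### Reduced words without braid factors -/

/-- No reduced word of `w` has a factor `i j i` with `|i - j| = 1`. -/
def BraidFree {n : ℕ} (w : Equiv.Perm (Fin (n + 1))) : Prop :=
  ∀ (a b : List (Fin n)) (i j : Fin n), Adjacent i j → ¬ IsReducedWord w (a ++ i :: j :: i :: b)

theorem IsReducedWord.braid {n : ℕ} {w : Equiv.Perm (Fin (n + 1))} {a b : List (Fin n)}
    {i j : Fin n} (hij : Adjacent i j) (hu : IsReducedWord w (a ++ i :: j :: i :: b)) :
    IsReducedWord w (a ++ j :: i :: j :: b) := by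
  refine hu.of_wordProd_eq ?_ (by simp)
  have := s_braid hij
  simp only [wordProd_append, wordProd_cons]
  simp only [← mul_assoc] at this ⊢
  rw [mul_assoc (wordProd a), mul_assoc (wordProd a), ← this]
  simp only [← mul_assoc]

/-- Commuting moves preserve the number of occurrences of every letter and braid moves do not. -/
theorem FullyCommutative.braidFree {n : ℕ} {w : Equiv.Perm (Fin (n + 1))}
    (hw : FullyCommutative w) : BraidFree w := by
  intro a b i j hij hu
  have hperm : ∀ u v : List (Fin n), Relation.ReflTransGen CommutingMove u v → u.Perm v := by
    intro u v huv
    induction huv with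
    | refl => exact List.Perm.refl _
    | tail _ hm ih =>
      obtain ⟨a, b, i, j, -, rfl, rfl⟩ := hm
      exact ih.trans ((List.Perm.swap j i b).append_left a)
  have h := (hperm _ _ (hw _ _ hu (hu.braid hij))).count_eq i
  have hne : j ≠ i := by
    rintro rfl
    unfold Adjacent at hij
    omega
  simp [hne] at h

/-- A braid factor `i (i + 1) i` of a reduced word reverses three elements that are in increasing
order before and in decreasing order after the whole product. -/
theorem Avoids321.braidFree {n : ℕ} {w : Equiv.Perm (Fin (n + 1))}
    (hw : Avoids321 w) : BraidFree w := by
  have key : ∀ (a b : List (Fin n)) (i j : Fin n), (i : ℕ) + 1 = j →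
      ¬ IsReducedWord w (a ++ i :: j :: i :: b) := by
    intro a b i j hij hu
    have hj : j.castSucc = i.succ := Fin.ext (by simp [hij])
    have f₁ : s j i.castSucc = i.castSucc := s_of_ne (by simp; omega) (by simp; omega)
    have f₂ : s i j.succ = j.succ := s_of_ne (by simp; omega) (by simp; omega)
    have f₃ : s j i.succ = j.succ := by rw [← hj, s_castSucc]
    have f₄ : s j j.succ = i.succ := by rw [← hj, s_succ]
    have hu₂ : IsReducedWord w ((a ++ [i]) ++ j :: (i :: b)) := by simpa using hu
    have hu₃ : IsReducedWord w ((a ++ [i, j]) ++ i :: b) := by simpa using hu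
    have p₁ := hu.inv_lt_inv
    have p₃ := hu₃.inv_lt_inv
    have q₁ := hu.lt
    have q₃ := hu₃.lt
    simp only [wordProd_append, wordProd_cons, wordProd_nil, mul_one, mul_inv_rev, s_inv,
      Equiv.Perm.mul_apply, f₁, f₂, f₃, s_castSucc] at p₁ p₃ q₁ q₃
    refine hw ⟨![(wordProd b)⁻¹ i.castSucc, (wordProd b)⁻¹ i.succ, (wordProd b)⁻¹ j.succ], ?_, ?_⟩
    · rw [Fin.strictMono_iff_lt_succ]
      intro t
      fin_cases t
      · exact p₃
      · exact p₁
    · have e₁ : w ((wordProd b)⁻¹ i.castSucc) = wordProd a j.succ := by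
        rw [← hu.1]
        simp [Equiv.Perm.mul_apply, f₂, f₃]
      have e₂ : w ((wordProd b)⁻¹ i.succ) = wordProd a i.succ := by
        rw [← hu.1]
        simp [Equiv.Perm.mul_apply, f₁]
      have e₃ : w ((wordProd b)⁻¹ j.succ) = wordProd a i.castSucc := by
        rw [← hu.1]
        simp [Equiv.Perm.mul_apply, f₂, f₄]
      intro x y hxy
      have hrev : ¬ (Fin.revPerm x < (Fin.revPerm y : Fin 3)) := by
        simpa using hxy.le
      refine iff_of_false ?_ hrev
      rw [not_lt]
      have g₁ : w ((wordProd b)⁻¹ i.succ) ≤ w ((wordProd b)⁻¹ i.castSucc) := by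
        rw [e₁, e₂]; exact q₃.le
      have g₂ : w ((wordProd b)⁻¹ j.succ) ≤ w ((wordProd b)⁻¹ i.succ) := by
        rw [e₂, e₃]; exact q₁.le
      fin_cases x <;> fin_cases y <;>
        first | exact g₁ | exact g₂ | exact g₂.trans g₁ | exact absurd hxy (by decide)
  intro a b i j hij hu
  rcases hij with h | h
  · exact key a b i j h hu
  · exact key a b j i h (hu.braid (Or.inr h))

/-- Between any two occurrences of a letter, both neighbouring letters occur.  In particular the
letters `0` and `n - 1` occur at most once. -/
def Alternating {n : ℕ} (u : List (Fin n)) : Prop :=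
  ∀ (a b c : List (Fin n)) (x : Fin n), u = a ++ x :: (b ++ x :: c) →
    (∃ y ∈ b, (y : ℕ) + 1 = x) ∧ ∃ y ∈ b, (y : ℕ) = x + 1

/-- Two equal letters that commute with everything in between can be cancelled. -/
theorem IsReducedWord.exists_adjacent {n : ℕ} {w : Equiv.Perm (Fin (n + 1))}
    {a b c : List (Fin n)} {x : Fin n} (hu : IsReducedWord w (a ++ x :: (b ++ x :: c))) :
    ∃ y ∈ b, Adjacent x y := by
  by_contra! hb
  have h : wordProd (a ++ (b ++ c)) = w := by
    rw [← hu.1]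
    simp only [wordProd_append, wordProd_cons]
    rw [← mul_assoc (s x), (commute_wordProd hb).eq, mul_assoc (wordProd b), ← mul_assoc (s x),
      s_mul_self, one_mul]
  have := hu.2 _ h
  simp at this

/-- Between two equal letters there are at least two letters adjacent to them, as otherwise
commutations produce a braid factor. -/
theorem BraidFree.exists_adjacent_of_split {n : ℕ} {w : Equiv.Perm (Fin (n + 1))}
    (hw : BraidFree w) {a b₁ b₂ c : List (Fin n)} {x z : Fin n} (hxz : Adjacent x z)
    (hu : IsReducedWord w (a ++ x :: ((b₁ ++ z :: b₂) ++ x :: c))) :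
    (∃ y ∈ b₁, Adjacent x y) ∨ ∃ y ∈ b₂, Adjacent x y := by
  by_contra! hb
  refine hw (a ++ b₁) (b₂ ++ c) x z hxz (hu.of_wordProd_eq ?_ ?_)
  · simp only [wordProd_append, wordProd_cons, mul_assoc]
    rw [← mul_assoc (s x) (wordProd b₁), (commute_wordProd hb.1).eq,
      ← mul_assoc (s x) (wordProd b₂), (commute_wordProd hb.2).eq]
    simp only [mul_assoc]
  · simp
    omega

/-- The relation `A x y` says that `y` is the neighbour of `x` on a fixed side, and `μ` counts the
columns on the other side.  If no such `y` occurred between two letters `x`, two copies of the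
opposite neighbour would occur there, with no `x` between them. -/
theorem BraidFree.exists_neighbour {n : ℕ} {w : Equiv.Perm (Fin (n + 1))} (hw : BraidFree w)
    {u : List (Fin n)} (hu : IsReducedWord w u) (A : Fin n → Fin n → Prop) (μ : Fin n → ℕ)
    (hA : ∀ x y, Adjacent x y ↔ A x y ∨ A y x) (hr : ∀ x y z, A x y → A x z → y = z)
    (hl : ∀ x y z, A x z → A y z → x = y) (hμ : ∀ x y, A x y → μ x < μ y)
    (N : ℕ) : ∀ (a b c : List (Fin n)) (x : Fin n), μ x ≤ N →
      u = a ++ x :: (b ++ x :: c) → ∃ y ∈ b, A x y := by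
  induction N with
  | zero =>
    intro a b c x hx h
    obtain ⟨y, hy, hxy⟩ := (h ▸ hu : IsReducedWord w _).exists_adjacent
    rcases (hA _ _).1 hxy with h' | h'
    · exact ⟨y, hy, h'⟩
    · have := hμ _ _ h'
      omega
  | succ N ihN =>
    intro a b
    induction hlen : b.length using Nat.strong_induction_on generalizing b with
    | _ l ihl =>
    intro c x hx h
    by_cases hxb : x ∈ b
    · obtain ⟨b', b'', rfl⟩ := List.append_of_mem hxb
      obtain ⟨y, hy, hxy⟩ := ihl b'.length (by simp at hlen; omega) b' rfl (b'' ++ x :: c) x hx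
        (by simpa using h)
      exact ⟨y, by simp [hy], hxy⟩
    by_contra! hno
    obtain ⟨z, hz, hxz⟩ := (h ▸ hu : IsReducedWord w _).exists_adjacent
    have hzx : A z x := ((hA _ _).1 hxz).resolve_left (hno z hz)
    have hzN : μ z ≤ N := by
      have := hμ _ _ hzx
      omega
    obtain ⟨b₁, b₂, rfl⟩ := List.append_of_mem hz
    rcases hw.exists_adjacent_of_split hxz (h ▸ hu) with ⟨y, hy, hxy⟩ | ⟨y, hy, hxy⟩
    · have hyx : A y x := ((hA _ _).1 hxy).resolve_left (hno y (by simp [hy]))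
      obtain rfl := hl _ _ _ hyx hzx
      obtain ⟨c₁, c₂, rfl⟩ := List.append_of_mem hy
      obtain ⟨t, ht, hyt⟩ := ihN (a ++ x :: c₁) c₂ (b₂ ++ x :: c) y hzN (by simpa using h)
      obtain rfl := hr _ _ _ hyx hyt
      exact hxb (by simp [ht])
    · have hyx : A y x := ((hA _ _).1 hxy).resolve_left (hno y (by simp [hy]))
      obtain rfl := hl _ _ _ hyx hzx
      obtain ⟨c₁, c₂, rfl⟩ := List.append_of_mem hy
      obtain ⟨t, ht, hyt⟩ := ihN (a ++ x :: b₁) c₁ (c₂ ++ x :: c) y hzN (by simpa using h)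
      obtain rfl := hr _ _ _ hyx hyt
      exact hxb (by simp [ht])

/-- Apply `BraidFree.exists_neighbour` to both sides of the column of the letter. -/
theorem BraidFree.alternating {n : ℕ} {w : Equiv.Perm (Fin (n + 1))} (hw : BraidFree w)
    {u : List (Fin n)} (hu : IsReducedWord w u) : Alternating u := by
  intro a b c x h
  constructor
  · refine hw.exists_neighbour hu (fun x y => (y : ℕ) + 1 = x) (fun x => n - x) ?_ ?_ ?_ ?_ _
      a b c x le_rfl h
    · intro x y; unfold Adjacent; tauto
    · intro x y z h₁ h₂; exact Fin.ext (by omega)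
    · intro x y z h₁ h₂; exact Fin.ext (by omega)
    · intro x y h; have := x.2; have := y.2; omega
  · refine hw.exists_neighbour hu (fun x y => (y : ℕ) = x + 1) (fun x => x) ?_ ?_ ?_ ?_ _
      a b c x le_rfl h
    · intro x y; unfold Adjacent; omega
    · intro x y z h₁ h₂; exact Fin.ext (by omega)
    · intro x y z h₁ h₂; exact Fin.ext (by omega)
    · intro x y h; omega

theorem exists_wordProd_eq {n : ℕ} (w : Equiv.Perm (Fin (n + 1))) : ∃ u, wordProd u = w := by
  have h : w ∈ Submonoid.closure (Set.range (s : Fin n → Equiv.Perm (Fin (n + 1)))) := by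
    have := Equiv.Perm.mclosure_swap_castSucc_succ n
    change Submonoid.closure (Set.range (s : Fin n → Equiv.Perm (Fin (n + 1)))) = ⊤ at this
    rw [this]
    trivial
  obtain ⟨l, hl, rfl⟩ := Submonoid.exists_list_of_mem_closure h
  clear h
  induction l with
  | nil => exact ⟨[], rfl⟩
  | cons x l ih =>
    obtain ⟨u, hu⟩ := ih fun y hy => hl y (by simp [hy])
    obtain ⟨i, rfl⟩ := hl x (by simp)
    exact ⟨i :: u, by simp [hu]⟩

theorem exists_isReducedWord {n : ℕ} (w : Equiv.Perm (Fin (n + 1))) : ∃ u, IsReducedWord w u := by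
  have h := exists_wordProd_eq w
  obtain ⟨u, hu, hmin⟩ := (measure (List.length (α := Fin n))).wf.has_min
    {u | wordProd u = w} h
  exact ⟨u, hu, fun v hv => not_lt.1 (hmin v hv)⟩

/-! ### Products of alternating words -/

theorem Alternating.reverse {n : ℕ} {u : List (Fin n)} (hu : Alternating u) :
    Alternating u.reverse := by
  intro a b c x h
  have h' : u = c.reverse ++ x :: (b.reverse ++ x :: a.reverse) := by
    rw [← List.reverse_reverse u, h]
    simp
  obtain ⟨⟨y, hy, h₁⟩, z, hz, h₂⟩ := hu _ _ _ _ h'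
  exact ⟨⟨y, by simpa using hy, h₁⟩, z, by simpa using hz, h₂⟩

theorem Alternating.of_append_left {n : ℕ} {u v : List (Fin n)} (h : Alternating (u ++ v)) :
    Alternating u := by
  rintro a b c x rfl
  exact h a b (c ++ v) x (by simp)

theorem wordProd_apply_of_forall_ne {n : ℕ} {t : List (Fin n)} {p : Fin (n + 1)}
    (h : ∀ y ∈ t, (y : ℕ) ≠ p ∧ (y : ℕ) + 1 ≠ p) : wordProd t p = p := by
  induction t with
  | nil => rfl
  | cons x t ih =>
    rw [wordProd_cons, Equiv.Perm.mul_apply, ih fun y hy => h y (by simp [hy])]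
    exact s_of_ne (h x (by simp)).1 (h x (by simp)).2

/-- In an alternating word an element that has just been moved up is never moved down afterwards:
the next letter that moves it lies in the next column. -/
theorem Alternating.le_wordProd {n : ℕ} (v : List (Fin n)) :
    ∀ (t₁ t₂ : List (Fin n)) (x : Fin n) (p : Fin (n + 1)), Alternating (v ++ (t₁ ++ x :: t₂)) →
      x.succ = p → (∀ y ∈ t₁, (y : ℕ) ≠ p ∧ (y : ℕ) + 1 ≠ p) → p ≤ wordProd v p := by
  induction v using List.reverseRecOn with
  | nil => intros; exact le_rfl
  | append_singleton v z ih =>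
    rintro t₁ t₂ x p hu hx ht
    have hx' : (x : ℕ) + 1 = p := by rw [← hx]; simp
    rw [wordProd_append, Equiv.Perm.mul_apply, wordProd_cons, wordProd_nil, mul_one]
    by_cases h₁ : (z : ℕ) + 1 = p
    · obtain rfl : z = x := Fin.ext (by omega)
      obtain ⟨-, y, hy, h₂⟩ := hu v t₁ t₂ z (by simp)
      exact absurd (h₂.trans hx') (ht y hy).1
    by_cases h₂ : (z : ℕ) = p
    · have hp : p = z.castSucc := Fin.ext (by simp [h₂])
      rw [hp, s_castSucc]
      exact Fin.castSucc_lt_succ.le.trans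
        (ih [] (t₁ ++ x :: t₂) z z.succ (by simpa using hu) rfl (by simp))
    · rw [s_of_ne h₂ h₁]
      refine ih (z :: t₁) t₂ x p (by simpa using hu) hx ?_
      simpa [h₁, h₂] using ht

/-- The downward counterpart of `Alternating.le_wordProd`. -/
theorem Alternating.wordProd_le {n : ℕ} (v : List (Fin n)) :
    ∀ (t₁ t₂ : List (Fin n)) (x : Fin n) (p : Fin (n + 1)), Alternating (v ++ (t₁ ++ x :: t₂)) →
      x.castSucc = p → (∀ y ∈ t₁, (y : ℕ) ≠ p ∧ (y : ℕ) + 1 ≠ p) → wordProd v p ≤ p := by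
  induction v using List.reverseRecOn with
  | nil => intros; exact le_rfl
  | append_singleton v z ih =>
    rintro t₁ t₂ x p hu hx ht
    have hx' : (x : ℕ) = p := by rw [← hx]; simp
    rw [wordProd_append, Equiv.Perm.mul_apply, wordProd_cons, wordProd_nil, mul_one]
    by_cases h₂ : (z : ℕ) = p
    · obtain rfl : z = x := Fin.ext (by omega)
      obtain ⟨⟨y, hy, h₂⟩, -⟩ := hu v t₁ t₂ z (by simp)
      exact absurd (h₂.trans hx') (ht y hy).2
    by_cases h₁ : (z : ℕ) + 1 = p
    · have hp : p = z.succ := Fin.ext (by simp [h₁])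
      rw [hp, s_succ]
      exact (ih [] (t₁ ++ x :: t₂) z z.castSucc (by simpa using hu) rfl (by simp)).trans
        Fin.castSucc_lt_succ.le
    · rw [s_of_ne h₂ h₁]
      refine ih (z :: t₁) t₂ x p (by simpa using hu) hx ?_
      simpa [h₁, h₂] using ht

/-- The two elements of an inversion are exchanged by some letter; from there on, and by symmetry up
to there, one of them only moves up and the other one only moves down. -/
theorem Alternating.lt_and_lt_of_inversion {n : ℕ} {u : List (Fin n)} (hu : Alternating u)
    {p q : Fin (n + 1)} (hpq : p < q) (h : wordProd u q < wordProd u p) :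
    p < wordProd u p ∧ wordProd u q < q := by
  obtain ⟨b₁, j, b₂, rfl, hp, hq⟩ := exists_split_of_inversion u hpq h
  have hr : Alternating (b₂.reverse ++ ([] ++ j :: b₁.reverse)) := by simpa using hu.reverse
  have hp' : (wordProd b₂)⁻¹ j.castSucc = p := by rw [← hp]; exact (wordProd b₂).symm_apply_apply p
  have hq' : (wordProd b₂)⁻¹ j.succ = q := by rw [← hq]; exact (wordProd b₂).symm_apply_apply q
  have e₁ := Alternating.le_wordProd b₁ [] b₂ j _ (by simpa using hu) rfl (by simp)
  have e₂ := Alternating.wordProd_le b₁ [] b₂ j _ (by simpa using hu) rfl (by simp)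
  have e₃ := Alternating.le_wordProd _ _ _ _ _ hr rfl (by simp)
  have e₄ := Alternating.wordProd_le _ _ _ _ _ hr rfl (by simp)
  rw [wordProd_reverse, hq'] at e₃
  rw [wordProd_reverse, hp'] at e₄
  have hj := Fin.castSucc_lt_succ (i := j)
  simp only [wordProd_append, wordProd_cons, Equiv.Perm.mul_apply, hp, hq, s_castSucc, s_succ]
  exact ⟨e₄.trans_lt (hj.trans_le e₁), e₂.trans_lt (hj.trans_le e₃)⟩

/-- The middle entry of a pattern `321` would have to move both up and down. -/
theorem Alternating.avoids321 {n : ℕ} {u : List (Fin n)} (hu : Alternating u) :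
    Avoids321 (wordProd u) := by
  rintro ⟨f, hf, h⟩
  have inv : ∀ a b : Fin 3, a < b → wordProd u (f b) < wordProd u (f a) := by
    intro a b hab
    have h₁ : ¬ wordProd u (f a) < wordProd u (f b) := by
      rw [h a b hab]; simpa using hab.le
    exact lt_of_le_of_ne (not_lt.1 h₁) fun h' =>
      hab.ne' (hf.injective ((wordProd u).injective h'))
  have h₁ := hu.lt_and_lt_of_inversion (hf (by decide : (0 : Fin 3) < 1)) (inv 0 1 (by decide))
  have h₂ := hu.lt_and_lt_of_inversion (hf (by decide : (1 : Fin 3) < 2)) (inv 1 2 (by decide))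
  exact lt_asymm h₁.2 h₂.1

/-! ### Counting letters in alternating words -/

/-- The number of letters in column `j`. -/
def colCount {n : ℕ} (j : ℕ) (u : List (Fin n)) : ℤ :=
  ((u.countP fun x : Fin n => decide ((x : ℕ) = j) : ℕ) : ℤ)

/-- The first letter of `u` in one of the columns `j`, `j + 1` lies in column `j`. -/
def FirstLeft {n : ℕ} (j : ℕ) : List (Fin n) → Prop
  | [] => False
  | x :: t => (x : ℕ) = j ∨ ((x : ℕ) ≠ j + 1 ∧ FirstLeft j t)

/-- The first letter of `u` in one of the columns `j`, `j + 1` lies in column `j + 1`. -/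
def FirstRight {n : ℕ} (j : ℕ) : List (Fin n) → Prop
  | [] => False
  | x :: t => (x : ℕ) = j + 1 ∨ ((x : ℕ) ≠ j ∧ FirstRight j t)

@[simp] theorem colCount_nil {n : ℕ} (j : ℕ) : colCount j ([] : List (Fin n)) = 0 := rfl

theorem colCount_cons {n : ℕ} (j : ℕ) (x : Fin n) (u : List (Fin n)) :
    colCount j (x :: u) = colCount j u + if (x : ℕ) = j then 1 else 0 := by
  unfold colCount
  rw [List.countP_cons]
  push_cast
  simp

theorem colCount_append {n : ℕ} (j : ℕ) (u v : List (Fin n)) :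
    colCount j (u ++ v) = colCount j u + colCount j v := by
  simp [colCount]

theorem colCount_nonneg {n : ℕ} (j : ℕ) (u : List (Fin n)) : 0 ≤ colCount j u :=
  Int.natCast_nonneg _

theorem colCount_eq_zero {n : ℕ} {j : ℕ} {u : List (Fin n)} :
    colCount j u = 0 ↔ ∀ x ∈ u, (x : ℕ) ≠ j := by
  simp [colCount]

theorem firstLeft_iff {n : ℕ} {j : ℕ} {u : List (Fin n)} :
    FirstLeft j u ↔
      ∃ (t₁ : List (Fin n)) (x : Fin n) (t₂ : List (Fin n)), u = t₁ ++ x :: t₂ ∧ (x : ℕ) = j ∧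
      ∀ y ∈ t₁, (y : ℕ) ≠ j ∧ (y : ℕ) ≠ j + 1 := by
  induction u with
  | nil => simp [FirstLeft]
  | cons x t ih =>
    rw [FirstLeft, ih]
    constructor
    · rintro (h | ⟨h, t₁, y, t₂, rfl, hy, ht⟩)
      · exact ⟨[], x, t, rfl, h, by simp⟩
      · by_cases hx : (x : ℕ) = j
        · exact ⟨[], x, _, rfl, hx, by simp⟩
        · exact ⟨x :: t₁, y, t₂, rfl, hy, by simpa [h, hx] using ht⟩
    · rintro ⟨t₁, y, t₂, h, hy, ht⟩
      cases t₁ with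
      | nil =>
        obtain ⟨rfl, rfl⟩ := List.cons.inj h
        exact Or.inl hy
      | cons z t₁ =>
        obtain ⟨rfl, rfl⟩ := List.cons.inj h
        exact Or.inr ⟨(ht x (by simp)).2, t₁, y, t₂, rfl, hy, fun z hz => ht z (by simp [hz])⟩

theorem firstRight_iff {n : ℕ} {j : ℕ} {u : List (Fin n)} :
    FirstRight j u ↔
      ∃ (t₁ : List (Fin n)) (x : Fin n) (t₂ : List (Fin n)), u = t₁ ++ x :: t₂ ∧ (x : ℕ) = j + 1 ∧
      ∀ y ∈ t₁, (y : ℕ) ≠ j ∧ (y : ℕ) ≠ j + 1 := by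
  induction u with
  | nil => simp [FirstRight]
  | cons x t ih =>
    rw [FirstRight, ih]
    constructor
    · rintro (h | ⟨h, t₁, y, t₂, rfl, hy, ht⟩)
      · exact ⟨[], x, t, rfl, h, by simp⟩
      · by_cases hx : (x : ℕ) = j + 1
        · exact ⟨[], x, _, rfl, hx, by simp⟩
        · exact ⟨x :: t₁, y, t₂, rfl, hy, by simpa [h, hx] using ht⟩
    · rintro ⟨t₁, y, t₂, h, hy, ht⟩
      cases t₁ with
      | nil =>
        obtain ⟨rfl, rfl⟩ := List.cons.inj h
        exact Or.inl hy
      | cons z t₁ =>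
        obtain ⟨rfl, rfl⟩ := List.cons.inj h
        exact Or.inr ⟨(ht x (by simp)).1, t₁, y, t₂, rfl, hy, fun z hz => ht z (by simp [hz])⟩

theorem colCount_eq_zero_of_not_first {n : ℕ} {j : ℕ} {u : List (Fin n)} (h₁ : ¬ FirstLeft j u)
    (h₂ : ¬ FirstRight j u) : colCount j u = 0 ∧ colCount (j + 1) u = 0 := by
  induction u with
  | nil => simp
  | cons x t ih =>
    rw [FirstLeft] at h₁
    rw [FirstRight] at h₂
    push Not at h₁ h₂
    obtain ⟨a, b⟩ := ih (h₁.2 h₂.1) (h₂.2 h₁.1)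
    rw [colCount_cons, colCount_cons, if_neg h₁.1, if_neg h₂.1, a, b]
    simp

theorem not_firstRight_of_firstLeft {n : ℕ} {j : ℕ} {u : List (Fin n)} (h : FirstLeft j u) :
    ¬ FirstRight j u := by
  induction u with
  | nil => exact h.elim
  | cons x t ih =>
    rw [FirstLeft] at h
    rw [FirstRight]
    rcases h with h | ⟨h, h'⟩
    · omega
    · exact fun h'' => h''.elim h fun h'' => ih h' h''.2

theorem FirstLeft.append {n : ℕ} {j : ℕ} {u : List (Fin n)} (h : FirstLeft j u)
    (v : List (Fin n)) : FirstLeft j (u ++ v) := by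
  rw [firstLeft_iff] at *
  obtain ⟨t₁, x, t₂, rfl, h⟩ := h
  exact ⟨t₁, x, t₂ ++ v, by simp, h⟩

theorem FirstRight.append {n : ℕ} {j : ℕ} {u : List (Fin n)} (h : FirstRight j u)
    (v : List (Fin n)) : FirstRight j (u ++ v) := by
  rw [firstRight_iff] at *
  obtain ⟨t₁, x, t₂, rfl, h⟩ := h
  exact ⟨t₁, x, t₂ ++ v, by simp, h⟩

theorem Alternating.of_cons {n : ℕ} {x : Fin n} {u : List (Fin n)} (h : Alternating (x :: u)) :
    Alternating u := by
  rintro a b c y rfl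
  exact h (x :: a) b c y rfl

/-- The letters of two neighbouring columns alternate, so that the numbers of their occurrences
differ by at most one, and the sign is determined by which of them comes first. -/
theorem Alternating.colCount_bounds {n : ℕ} (j : ℕ) (u : List (Fin n)) (hu : Alternating u) :
    (FirstLeft j u → 0 ≤ colCount j u - colCount (j + 1) u ∧
      colCount j u - colCount (j + 1) u ≤ 1) ∧
    (FirstRight j u → -1 ≤ colCount j u - colCount (j + 1) u ∧
      colCount j u - colCount (j + 1) u ≤ 0) := by
  induction u with
  | nil => exact ⟨False.elim, False.elim⟩
  | cons x t ih =>
    obtain ⟨ih₁, ih₂⟩ := ih hu.of_cons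
    rw [FirstLeft, FirstRight, colCount_cons, colCount_cons]
    by_cases h₁ : (x : ℕ) = j
    · have hno : ¬ FirstLeft j t := by
        rw [firstLeft_iff]
        rintro ⟨t₁, y, t₂, rfl, hy, ht⟩
        obtain rfl : x = y := Fin.ext (by omega)
        obtain ⟨-, z, hz, hz'⟩ := hu [] t₁ t₂ x rfl
        exact (ht z hz).2 (by omega)
      have h₂ : (x : ℕ) ≠ j + 1 := by omega
      rw [if_pos h₁, if_neg h₂]
      by_cases hr : FirstRight j t
      · have := ih₂ hr
        exact ⟨fun _ => by omega, fun h => absurd h (by tauto)⟩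
      · have := colCount_eq_zero_of_not_first hno hr
        exact ⟨fun _ => by omega, fun h => absurd h (by tauto)⟩
    by_cases h₂ : (x : ℕ) = j + 1
    · have hno : ¬ FirstRight j t := by
        rw [firstRight_iff]
        rintro ⟨t₁, y, t₂, rfl, hy, ht⟩
        obtain rfl : x = y := Fin.ext (by omega)
        obtain ⟨⟨z, hz, hz'⟩, -⟩ := hu [] t₁ t₂ x rfl
        exact (ht z hz).1 (by omega)
      rw [if_neg h₁, if_pos h₂]
      by_cases hr : FirstLeft j t
      · have := ih₁ hr
        exact ⟨fun h => absurd h (by tauto), fun _ => by omega⟩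
      · have := colCount_eq_zero_of_not_first hr hno
        exact ⟨fun h => absurd h (by tauto), fun _ => by omega⟩
    · rw [if_neg h₁, if_neg h₂]
      simp only [h₁, h₂, false_or, ne_eq, not_false_eq_true, true_and, add_zero]
      exact ⟨ih₁, ih₂⟩

theorem Alternating.prefix_bounds {n : ℕ} (j : ℕ) {u v : List (Fin n)}
    (hu : Alternating (u ++ v)) :
    (FirstLeft j (u ++ v) → 0 ≤ colCount j u - colCount (j + 1) u ∧
      colCount j u - colCount (j + 1) u ≤ 1) ∧
    (¬ FirstLeft j (u ++ v) → -1 ≤ colCount j u - colCount (j + 1) u ∧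
      colCount j u - colCount (j + 1) u ≤ 0) := by
  obtain ⟨h₁, h₂⟩ := Alternating.colCount_bounds j u hu.of_append_left
  by_cases hl : FirstLeft j u
  · exact ⟨fun _ => h₁ hl, fun h => absurd (hl.append v) h⟩
  by_cases hr : FirstRight j u
  · exact ⟨fun h => absurd (hr.append v) (not_firstRight_of_firstLeft h), fun _ => h₂ hr⟩
  · have := colCount_eq_zero_of_not_first hl hr
    exact ⟨fun _ => by omega, fun _ => by omega⟩

/-- The difference of the numbers of occurrences of two neighbouring letters, in terms of the
first and of the last of these occurrences. -/
theorem Alternating.colCount_sub {n : ℕ} (j : ℕ) {u : List (Fin n)} (hu : Alternating u) :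
    2 * (colCount j u - colCount (j + 1) u) =
      (open Classical in if FirstLeft j u then 1 else -1) -
        (open Classical in if FirstRight j u.reverse then 1 else -1) := by
  classical
  have hb := Alternating.prefix_bounds j (u := u) (v := []) (by simpa using hu)
  rw [List.append_nil] at hb
  by_cases hr : FirstRight j u.reverse
  · obtain ⟨t₁, x, t₂, h, hx, ht⟩ := firstRight_iff.1 hr
    have h' : u = t₂.reverse ++ x :: t₁.reverse := by
      rw [← List.reverse_reverse u, h]; simp
    have hb' := Alternating.prefix_bounds j (u := t₂.reverse) (v := x :: t₁.reverse) (h' ▸ hu)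
    rw [← h'] at hb'
    have c₁ : colCount j t₁.reverse = 0 :=
      colCount_eq_zero.2 fun y hy => (ht y (by simpa using hy)).1
    have c₂ : colCount (j + 1) t₁.reverse = 0 :=
      colCount_eq_zero.2 fun y hy => (ht y (by simpa using hy)).2
    have e₁ : colCount j u = colCount j t₂.reverse := by
      rw [h', colCount_append, colCount_cons, if_neg (by omega), c₁]; simp
    have e₂ : colCount (j + 1) u = colCount (j + 1) t₂.reverse + 1 := by
      rw [h', colCount_append, colCount_cons, if_pos hx, c₂]; simp
    rw [if_pos hr]
    split_ifs with hf
    · have := hb.1 hf; have := hb'.1 hf; omega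
    · have := hb.2 hf; have := hb'.2 hf; omega
  rw [if_neg hr]
  by_cases hl : FirstLeft j u.reverse
  · obtain ⟨t₁, x, t₂, h, hx, ht⟩ := firstLeft_iff.1 hl
    have h' : u = t₂.reverse ++ x :: t₁.reverse := by
      rw [← List.reverse_reverse u, h]; simp
    have hb' := Alternating.prefix_bounds j (u := t₂.reverse) (v := x :: t₁.reverse) (h' ▸ hu)
    rw [← h'] at hb'
    have c₁ : colCount j t₁.reverse = 0 :=
      colCount_eq_zero.2 fun y hy => (ht y (by simpa using hy)).1
    have c₂ : colCount (j + 1) t₁.reverse = 0 :=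
      colCount_eq_zero.2 fun y hy => (ht y (by simpa using hy)).2
    have e₁ : colCount j u = colCount j t₂.reverse + 1 := by
      rw [h', colCount_append, colCount_cons, if_pos hx, c₁]; simp
    have e₂ : colCount (j + 1) u = colCount (j + 1) t₂.reverse := by
      rw [h', colCount_append, colCount_cons, if_neg (by omega), c₂]; simp
    split_ifs with hf
    · have := hb.1 hf; have := hb'.1 hf; omega
    · have := hb.2 hf; have := hb'.2 hf; omega
  · obtain ⟨e₁, e₂⟩ := colCount_eq_zero_of_not_first hl hr
    have e₁' : colCount j u = 0 := by
      rw [colCount_eq_zero] at e₁ ⊢; simpa using e₁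
    have e₂' : colCount (j + 1) u = 0 := by
      rw [colCount_eq_zero] at e₂ ⊢; simpa using e₂
    have hf : ¬ FirstLeft j u := by
      rw [firstLeft_iff]
      rintro ⟨t₁, x, t₂, rfl, hx, -⟩
      exact colCount_eq_zero.1 e₁' x (by simp) hx
    rw [if_neg hf]
    omega

/-! ### Excedances of products of alternating words -/

/-- Whether `p` is an excedance depends on which of the two letters that move `p` occurs last, since
the last letter acts first. -/
theorem Alternating.lt_wordProd_iff {n : ℕ} {u : List (Fin n)} (hu : Alternating u) {j : ℕ}
    {p : Fin (n + 1)} (hp : (p : ℕ) = j + 1) : p < wordProd u p ↔ FirstRight j u.reverse := by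
  by_cases hr : FirstRight j u.reverse
  · refine iff_of_true ?_ hr
    obtain ⟨t₁, x, t₂, h, hx, ht⟩ := firstRight_iff.1 hr
    have h' : u = t₂.reverse ++ ([] ++ x :: t₁.reverse) := by
      rw [← List.reverse_reverse u, h]; simp
    have h₁ := Alternating.le_wordProd _ _ _ _ _ (h' ▸ hu) rfl (by simp)
    have hpx : p = x.castSucc := Fin.ext (by simp; omega)
    rw [h', List.nil_append, wordProd_append, wordProd_cons, Equiv.Perm.mul_apply,
      Equiv.Perm.mul_apply, wordProd_apply_of_forall_ne (t := t₁.reverse), hpx, s_castSucc]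
    · exact Fin.castSucc_lt_succ.trans_le h₁
    · intro y hy
      have := ht y (by simpa using hy)
      omega
  by_cases hl : FirstLeft j u.reverse
  · refine iff_of_false (not_lt.2 ?_) hr
    obtain ⟨t₁, x, t₂, h, hx, ht⟩ := firstLeft_iff.1 hl
    have h' : u = t₂.reverse ++ ([] ++ x :: t₁.reverse) := by
      rw [← List.reverse_reverse u, h]; simp
    have h₁ := Alternating.wordProd_le _ _ _ _ _ (h' ▸ hu) rfl (by simp)
    have hpx : p = x.succ := Fin.ext (by simp; omega)
    rw [h', List.nil_append, wordProd_append, wordProd_cons, Equiv.Perm.mul_apply,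
      Equiv.Perm.mul_apply, wordProd_apply_of_forall_ne (t := t₁.reverse), hpx, s_succ]
    · exact h₁.trans Fin.castSucc_lt_succ.le
    · intro y hy
      have := ht y (by simpa using hy)
      omega
  · refine iff_of_false (not_lt.2 (le_of_eq ?_)) hr
    obtain ⟨e₁, e₂⟩ := colCount_eq_zero_of_not_first hl hr
    rw [colCount_eq_zero] at e₁ e₂
    refine wordProd_apply_of_forall_ne fun y hy => ?_
    have := e₁ y (by simpa using hy)
    have := e₂ y (by simpa using hy)
    omega

theorem Alternating.inv_lt_iff {n : ℕ} {u : List (Fin n)} (hu : Alternating u) {j : ℕ}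
    {p : Fin (n + 1)} (hp : (p : ℕ) = j + 1) : (wordProd u)⁻¹ p < p ↔ FirstLeft j u := by
  rw [← wordProd_reverse]
  by_cases hl : FirstLeft j u
  · refine iff_of_true ?_ hl
    obtain ⟨t₁, x, t₂, h, hx, ht⟩ := firstLeft_iff.1 hl
    have h' : u.reverse = t₂.reverse ++ ([] ++ x :: t₁.reverse) := by
      rw [h]; simp
    have h₁ := Alternating.wordProd_le _ _ _ _ _ (h' ▸ hu.reverse) rfl (by simp)
    have hpx : p = x.succ := Fin.ext (by simp; omega)
    rw [h', List.nil_append, wordProd_append, wordProd_cons, Equiv.Perm.mul_apply,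
      Equiv.Perm.mul_apply, wordProd_apply_of_forall_ne (t := t₁.reverse), hpx, s_succ]
    · exact h₁.trans_lt Fin.castSucc_lt_succ
    · intro y hy
      have := ht y (by simpa using hy)
      omega
  · refine iff_of_false ?_ hl
    intro hlt
    by_cases hr : FirstRight j u
    · have := (hu.reverse.lt_wordProd_iff hp).2 (by simpa using hr)
      exact lt_asymm hlt this
    · obtain ⟨e₁, e₂⟩ := colCount_eq_zero_of_not_first hl hr
      rw [colCount_eq_zero] at e₁ e₂
      refine hlt.ne (wordProd_apply_of_forall_ne fun y hy => ?_)
      have := e₁ y (by simpa using hy)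
      have := e₂ y (by simpa using hy)
      omega

theorem Alternating.colCount_zero {n : ℕ} {u : List (Fin n)} (hu : Alternating u) :
    2 * colCount 0 u = 1 + if (0 : Fin (n + 1)) < wordProd u 0 then 1 else -1 := by
  by_cases h : ∃ x ∈ u, (x : ℕ) = 0
  · obtain ⟨x, hx, hx0⟩ := h
    obtain ⟨a, b, rfl⟩ := List.append_of_mem hx
    have ha : colCount 0 a = 0 := colCount_eq_zero.2 fun y hy hy0 => by
      obtain rfl : x = y := Fin.ext (by omega)
      obtain ⟨a₁, a₂, rfl⟩ := List.append_of_mem hy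
      obtain ⟨⟨z, -, hz⟩, -⟩ := hu a₁ a₂ b x (by simp)
      omega
    have hb : colCount 0 b = 0 := colCount_eq_zero.2 fun y hy hy0 => by
      obtain rfl : x = y := Fin.ext (by omega)
      obtain ⟨a₁, a₂, rfl⟩ := List.append_of_mem hy
      obtain ⟨⟨z, -, hz⟩, -⟩ := hu a a₁ a₂ x (by simp)
      omega
    have h₁ := Alternating.le_wordProd a [] b x _ (by simpa using hu) rfl (by simp)
    have hpx : (0 : Fin (n + 1)) = x.castSucc := Fin.ext (by simp [hx0])
    rw [if_pos]
    · rw [colCount_append, colCount_cons, ha, hb, if_pos hx0]; norm_num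
    · rw [wordProd_append, wordProd_cons, Equiv.Perm.mul_apply,
        Equiv.Perm.mul_apply, wordProd_apply_of_forall_ne (t := b), hpx, s_castSucc]
      · exact Fin.castSucc_lt_succ.trans_le h₁
      · intro y hy
        have := colCount_eq_zero.1 hb y hy
        simp [this]
  · push Not at h
    rw [colCount_eq_zero.2 h, wordProd_apply_of_forall_ne]
    · simp
    · intro y hy
      simp [h y hy]

theorem Alternating.colCount_last {n : ℕ} {u : List (Fin n)} (hu : Alternating u) {j : ℕ}
    (hj : j + 1 = n) : colCount j u ≤ 1 := by
  have h₁ : colCount (j + 1) u = 0 := colCount_eq_zero.2 fun x _ => by have := x.2; omega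
  have h₂ := Alternating.prefix_bounds j (u := u) (v := []) (by simpa using hu)
  by_cases h : FirstLeft j (u ++ [])
  · have := h₂.1 h; omega
  · have := h₂.2 h; omega

/-! ### The pair of lattice paths of a permutation -/

/-- A Boolean as a step `1` or `-1` of a lattice path. -/
def sgn (b : Bool) : ℤ := if b then 1 else -1

/-- For each column `i` of `w`, whether `i` is a (strict) excedance of `w`, and whether `i + 1` is a
(strict) excedance value, that is, an anti-excedance of `w⁻¹`. -/
def steps {n : ℕ} (w : Equiv.Perm (Fin (n + 1))) : List (Bool × Bool) :=
  List.ofFn fun i : Fin n => (decide (i.castSucc < w i.castSucc), decide (w⁻¹ i.succ < i.succ))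

/-- The height after `j` steps of the path formed by the first components. -/
def sumFst (P : List (Bool × Bool)) (j : ℕ) : ℤ := ((P.take j).map fun a => sgn a.1).sum

/-- The height after `j` steps of the path formed by the second components. -/
def sumSnd (P : List (Bool × Bool)) (j : ℕ) : ℤ := ((P.take j).map fun a => sgn a.2).sum

/-- The height of the lowest lattice point of the heap in column `j`. -/
def lower (P : List (Bool × Bool)) (j : ℕ) : ℤ := sumSnd P j

/-- The height of the highest lattice point of the heap in column `j`; the column is empty if it
equals `lower P j - 2`. -/
def upper (P : List (Bool × Bool)) (j : ℕ) : ℤ := sumFst P (j + 1) - 1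

theorem sgn_eq (b : Bool) : sgn b = 1 ∨ sgn b = -1 := by
  cases b <;> simp [sgn]

@[simp] theorem sumFst_zero (P : List (Bool × Bool)) : sumFst P 0 = 0 := rfl

@[simp] theorem sumSnd_zero (P : List (Bool × Bool)) : sumSnd P 0 = 0 := rfl

theorem sumFst_succ (P : List (Bool × Bool)) (j : ℕ) (hj : j < P.length) :
    sumFst P (j + 1) = sumFst P j + sgn P[j].1 := by
  unfold sumFst
  rw [← List.take_append_getElem hj, List.map_append, List.sum_append, List.map_singleton,
    List.sum_singleton]

theorem sumSnd_succ (P : List (Bool × Bool)) (j : ℕ) (hj : j < P.length) :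
    sumSnd P (j + 1) = sumSnd P j + sgn P[j].2 := by
  unfold sumSnd
  rw [← List.take_append_getElem hj, List.map_append, List.sum_append, List.map_singleton,
    List.sum_singleton]

theorem sumFst_parity (P : List (Bool × Bool)) (j : ℕ) (hj : j ≤ P.length) :
    (sumFst P j - j) % 2 = 0 := by
  induction j with
  | zero => simp
  | succ j ih =>
    have h₁ := ih (by omega)
    have h₂ := sumFst_succ P j hj
    rcases sgn_eq P[j].1 with h | h <;> push_cast <;> omega

theorem sumSnd_parity (P : List (Bool × Bool)) (j : ℕ) (hj : j ≤ P.length) :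
    (sumSnd P j - j) % 2 = 0 := by
  induction j with
  | zero => simp
  | succ j ih =>
    have h₁ := ih (by omega)
    have h₂ := sumSnd_succ P j hj
    rcases sgn_eq P[j].2 with h | h <;> push_cast <;> omega

@[simp] theorem length_steps {n : ℕ} (w : Equiv.Perm (Fin (n + 1))) : (steps w).length = n := by
  simp [steps]

theorem lower_steps_succ {n : ℕ} {u : List (Fin n)} (hu : Alternating u) {j : ℕ} (hj : j < n) :
    lower (steps (wordProd u)) (j + 1) = lower (steps (wordProd u)) j +
      (open Classical in if FirstLeft j u then 1 else -1) := by
  classical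
  rw [lower, lower, sumSnd_succ _ _ (by simpa using hj)]
  have := hu.inv_lt_iff (p := (⟨j, hj⟩ : Fin n).succ) (j := j) (by simp)
  rw [if_congr this.symm rfl rfl]
  simp [steps, sgn]

theorem upper_steps_succ {n : ℕ} {u : List (Fin n)} (hu : Alternating u) {j : ℕ}
    (hj : j + 1 < n) :
    upper (steps (wordProd u)) (j + 1) = upper (steps (wordProd u)) j +
      (open Classical in if FirstRight j u.reverse then 1 else -1) := by
  classical
  rw [upper, upper, sumFst_succ _ _ (by simpa using hj)]
  have := hu.lt_wordProd_iff (p := (⟨j + 1, hj⟩ : Fin n).castSucc) (j := j) (by simp)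
  rw [if_congr this.symm rfl rfl]
  simp [steps, sgn]
  ring

/-- The number of lattice points of a column is the number of occurrences of the letter. -/
theorem Alternating.upper_sub_lower {n : ℕ} {u : List (Fin n)} (hu : Alternating u) {j : ℕ}
    (hj : j < n) :
    upper (steps (wordProd u)) j - lower (steps (wordProd u)) j = 2 * colCount j u - 2 := by
  induction j with
  | zero =>
    rw [hu.colCount_zero, upper, lower, sumFst_succ _ _ (by simpa using hj)]
    obtain ⟨n, rfl⟩ := Nat.exists_eq_succ_of_ne_zero hj.ne'
    simp only [steps, sgn, sumFst_zero, sumSnd_zero, List.getElem_ofFn, decide_eq_true_eq]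
    change 0 + (if (0 : Fin (n + 1 + 1)) < wordProd u 0 then (1 : ℤ) else -1) - 1 - 0 = _
    ring
  | succ j ih =>
    have h₁ := ih (by omega)
    have h₂ := lower_steps_succ hu (j := j) (by omega)
    have h₃ := upper_steps_succ hu hj
    have h₄ := hu.colCount_sub j
    omega

/-! ### Heaps as sets of lattice points -/

/-- The heap of `u` occupies the columns `c, …, c + K - 1` and is the set of lattice points between
the paths `lo` and `hi`, via the height function `y` on the positions of `u`; the position `p` is
the point `(u.get p, y p)`, the sum of whose coordinates is even.  In each of the two outermost
columns there is at most one point. -/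
structure IsHeapShape {n : ℕ} (u : List (Fin n)) (c K : ℕ) (lo hi : ℕ → ℤ)
    (y : Fin u.length → ℤ) : Prop where
  lo_step : ∀ j, c ≤ j → j + 1 < c + K → lo (j + 1) = lo j + 1 ∨ lo (j + 1) = lo j - 1
  hi_step : ∀ j, c ≤ j → j + 1 < c + K → hi (j + 1) = hi j + 1 ∨ hi (j + 1) = hi j - 1
  first : 0 < K → hi c ≤ lo c
  last : ∀ j, c ≤ j → j + 1 = c + K → hi j ≤ lo j
  lo_parity : ∀ j, c ≤ j → j < c + K → (lo j - j) % 2 = 0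
  hi_parity : ∀ j, c ≤ j → j < c + K → (hi j - j) % 2 = 0
  parity : ∀ p, (y p - (u.get p : ℕ)) % 2 = 0
  le_column : ∀ p, c ≤ (u.get p : ℕ)
  column_lt : ∀ p, (u.get p : ℕ) < c + K
  lo_le : ∀ p, lo (u.get p) ≤ y p
  le_hi : ∀ p, y p ≤ hi (u.get p)
  exists_pos : ∀ j, c ≤ j → j < c + K → ∀ z : ℤ, lo j ≤ z → z ≤ hi j → (z - j) % 2 = 0 →
    ∃ p, (u.get p : ℕ) = j ∧ y p = z
  lt_iff : ∀ p q, u.get p = u.get q ∨ Adjacent (u.get p) (u.get q) → (p < q ↔ y p < y q)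

theorem exists_get_colCount_take {n : ℕ} (j : ℕ) (u : List (Fin n)) :
    ∀ r : ℤ, 0 ≤ r → r < colCount j u →
      ∃ p : Fin u.length, (u.get p : ℕ) = j ∧ colCount j (u.take p) = r := by
  induction u with
  | nil => intro r h₁ h₂; rw [colCount_nil] at h₂; omega
  | cons x t ih =>
    intro r h₁ h₂
    rw [colCount_cons] at h₂
    by_cases hx : (x : ℕ) = j
    · rw [if_pos hx] at h₂
      rcases h₁.eq_or_lt with rfl | h₁
      · exact ⟨⟨0, by simp⟩, by simpa using hx, by simp⟩
      · obtain ⟨p, hp, hp'⟩ := ih (r - 1) (by omega) (by omega)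
        refine ⟨p.succ, by simpa using hp, ?_⟩
        simp [colCount_cons, hx, hp']
    · rw [if_neg hx] at h₂
      obtain ⟨p, hp, hp'⟩ := ih r (by omega) (by omega)
      refine ⟨p.succ, by simpa using hp, ?_⟩
      simp [colCount_cons, hx, hp']

theorem colCount_take_lt {n : ℕ} (u : List (Fin n)) (p : Fin u.length) {q : ℕ}
    (hpq : (p : ℕ) < q) : colCount (u.get p) (u.take p) + 1 ≤ colCount (u.get p) (u.take q) := by
  have h : u.take q = (u.take p ++ [u.get p]) ++ (u.take q).drop (p + 1) := by
    conv_lhs => rw [← List.take_append_drop (p + 1) (u.take q)]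
    rw [List.take_take, min_eq_left (by omega)]
    congr 1
    exact (List.take_append_getElem p.2).symm
  rw [h, colCount_append, colCount_append, colCount_cons, if_pos rfl, colCount_nil]
  have := colCount_nonneg (u.get p : ℕ) ((u.take q).drop (p + 1))
  omega

/-- The height of a position is determined by the number of earlier occurrences of its letter. -/
theorem Alternating.isHeapShape {n : ℕ} {u : List (Fin n)} (hu : Alternating u) :
    IsHeapShape u 0 n (lower (steps (wordProd u))) (upper (steps (wordProd u)))
      fun p => lower (steps (wordProd u)) (u.get p) + 2 * colCount (u.get p) (u.take p) := by
  classical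
  have hlp : ∀ j, j < n → (lower (steps (wordProd u)) j - j) % 2 = 0 := fun j hj =>
    sumSnd_parity _ _ (by simpa using hj.le)
  have hmono : ∀ p q : Fin u.length, u.get p = u.get q ∨ Adjacent (u.get p) (u.get q) → p < q →
      lower (steps (wordProd u)) (u.get p) + 2 * colCount (u.get p) (u.take p) <
      lower (steps (wordProd u)) (u.get q) + 2 * colCount (u.get q) (u.take q) := by
    intro p q h hpq
    have h₁ := colCount_take_lt u p hpq
    rcases h with h | h | h
    · rw [← h]
      omega
    · have hb := Alternating.prefix_bounds (u.get p : ℕ) (u := u.take q) (v := u.drop q)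
        (by simpa using hu)
      rw [List.take_append_drop] at hb
      have hl := lower_steps_succ hu (j := (u.get p : ℕ)) (u.get p).2
      rw [← h]
      split_ifs at hl with hf
      · have := hb.1 hf; omega
      · have := hb.2 hf; omega
    · have hb := Alternating.prefix_bounds (u.get q : ℕ) (u := u.take q) (v := u.drop q)
        (by simpa using hu)
      rw [List.take_append_drop] at hb
      have hl := lower_steps_succ hu (j := (u.get q : ℕ)) (u.get q).2
      rw [h] at hb hl
      split_ifs at hl with hf
      · have := hb.1 hf; omega
      · have := hb.2 hf; omega
  have hlen : (steps (wordProd u)).length = n := length_steps _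
  refine ⟨?_, ?_, ?_, ?_, ?_, ?_, ?_, fun p => Nat.zero_le _, fun p => ?_, ?_, ?_, ?_, ?_⟩
  · intro j _ hj
    have := lower_steps_succ hu (j := j) (by omega)
    split_ifs at this <;> omega
  · intro j _ hj
    have := upper_steps_succ hu (j := j) (by omega)
    split_ifs at this <;> omega
  · intro hn
    have h₁ := hu.upper_sub_lower hn
    have h₂ := hu.colCount_zero
    split_ifs at h₂ <;> omega
  · intro j _ hj
    have h₁ := hu.upper_sub_lower (j := j) (by omega)
    have h₂ := hu.colCount_last (j := j) (by omega)
    omega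
  · intro j _ hj
    exact hlp j (by omega)
  · intro j _ hj
    have := sumFst_parity (steps (wordProd u)) (j + 1) (by omega)
    rw [upper]
    push_cast at this
    omega
  · intro p
    have := hlp (u.get p) (u.get p).2
    omega
  · rw [zero_add]; exact (u.get p).2
  · intro p
    have := colCount_nonneg (u.get p : ℕ) (u.take p)
    omega
  · intro p
    have h₁ := hu.upper_sub_lower (u.get p).2
    have h₂ := colCount_take_lt u p p.2
    rw [List.take_length] at h₂
    omega
  · intro j _ hj z h₁ h₂ h₃
    have h₄ := hlp j (by omega)
    have h₅ := hu.upper_sub_lower (j := j) (by omega)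
    obtain ⟨p, hp, hp'⟩ := exists_get_colCount_take j u ((z - lower (steps (wordProd u)) j) / 2)
      (by omega) (by omega)
    refine ⟨p, hp, ?_⟩
    simp only [hp, hp']
    omega
  · intro p q h
    refine ⟨hmono p q h, fun hlt => ?_⟩
    rcases lt_trichotomy p q with h' | rfl | h'
    · exact h'
    · exact absurd hlt (lt_irrefl _)
    · exact absurd (hmono q p (h.imp Eq.symm Adjacent.symm) h') (not_lt.2 hlt.le)

namespace IsHeapShape

variable {n : ℕ} {u : List (Fin n)} {c K : ℕ} {lo hi : ℕ → ℤ} {y : Fin u.length → ℤ}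

theorem pos_ext (h : IsHeapShape u c K lo hi y) {p q : Fin u.length}
    (hc : (u.get p : ℕ) = u.get q) (hy : y p = y q) : p = q := by
  have hc' : u.get p = u.get q := Fin.ext hc
  rcases lt_trichotomy p q with h' | h' | h'
  · exact absurd ((h.lt_iff p q (Or.inl hc')).1 h') (by omega)
  · exact h'
  · exact absurd ((h.lt_iff q p (Or.inl hc'.symm)).1 h') (by omega)

theorem heapLT_of_adjacent (h : IsHeapShape u c K lo hi y) {p q : Fin u.length}
    (hc : Adjacent (u.get p) (u.get q)) (hy : y p < y q) : heapLT u p q :=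
  Relation.TransGen.single ⟨(h.lt_iff p q (Or.inr hc)).2 hy, hc⟩

theorem heapLT_of_eq (h : IsHeapShape u c K lo hi y) {p q : Fin u.length}
    (hc : (u.get p : ℕ) = u.get q) (hy : y p < y q) : heapLT u p q := by
  have h₁ := h.le_column p
  have h₂ := h.column_lt p
  have h₃ := h.lo_le p
  have h₄ := h.le_hi q
  have h₅ := h.parity p
  have h₆ := h.parity q
  rw [← hc] at h₄ h₆
  by_cases hlast : (u.get p : ℕ) + 1 = c + K
  · have := h.last _ h₁ hlast
    omega
  have h₇ := h.lo_step _ h₁ (by omega)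
  have h₈ := h.hi_step _ h₁ (by omega)
  obtain ⟨r, hr, hr'⟩ := h.exists_pos (u.get p + 1) (by omega) (by omega) (y p + 1) (by omega)
    (by omega) (by push_cast; omega)
  exact (h.heapLT_of_adjacent (q := r) (Or.inl hr.symm) (by omega)).trans
    (h.heapLT_of_adjacent (Or.inr (hc ▸ hr.symm)) (by omega))

theorem bounds_of_heapLT (h : IsHeapShape u c K lo hi y) {p q : Fin u.length}
    (hpq : heapLT u p q) : y p < y q ∧ ((u.get q : ℕ) : ℤ) - (u.get p : ℕ) ≤ y q - y p ∧
      ((u.get p : ℕ) : ℤ) - (u.get q : ℕ) ≤ y q - y p := by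
  have hstep : ∀ p q, p < q ∧ Adjacent (u.get p) (u.get q) → y p < y q ∧
      ((u.get q : ℕ) : ℤ) - (u.get p : ℕ) ≤ y q - y p ∧
      ((u.get p : ℕ) : ℤ) - (u.get q : ℕ) ≤ y q - y p := by
    rintro p q ⟨h₁, h₂⟩
    have := (h.lt_iff p q (Or.inr h₂)).1 h₁
    unfold Adjacent at h₂
    omega
  induction hpq with
  | single h' => exact hstep _ _ h'
  | tail _ h' ih =>
    have := hstep _ _ h'
    omega

theorem lo_lipschitz (h : IsHeapShape u c K lo hi y) (i m : ℕ) (h₁ : c ≤ i) (h₂ : i + m < c + K) :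
    lo (i + m) ≤ lo i + m ∧ lo i ≤ lo (i + m) + m := by
  induction m with
  | zero => simp
  | succ m ih =>
    have h₃ := ih (by omega)
    have h₄ := h.lo_step (i + m) (by omega) (by omega)
    rw [← add_assoc]
    push_cast
    omega

theorem hi_lipschitz (h : IsHeapShape u c K lo hi y) (i m : ℕ) (h₁ : c ≤ i) (h₂ : i + m < c + K) :
    hi (i + m) ≤ hi i + m ∧ hi i ≤ hi (i + m) + m := by
  induction m with
  | zero => simp
  | succ m ih =>
    have h₃ := ih (by omega)
    have h₄ := h.hi_step (i + m) (by omega) (by omega)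
    rw [← add_assoc]
    push_cast
    omega

/-- The entries of the columns of `v` in the heap of `u` that lie between two points of a translate
of the heap of `v` belong to this translate.  Points outside of the columns of `v` are excluded
because the outermost columns of `v` have at most one entry. -/
theorem mem_of_between {v : List (Fin n)} {lo' hi' : ℕ → ℤ} {y' : Fin v.length → ℤ} {c' K' : ℕ}
    (hu : IsHeapShape u c K lo hi y) (hv : IsHeapShape v c' K' lo' hi' y') {d : ℤ}
    (hd : d % 2 = 0) {p q : Fin v.length} {a b z : Fin u.length}
    (ha : (u.get a : ℕ) = v.get p) (ha' : y a = y' p + d)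
    (hb : (u.get b : ℕ) = v.get q) (hb' : y b = y' q + d)
    (haz : heapLT u a z) (hzb : heapLT u z b) :
    ∃ r, (v.get r : ℕ) = u.get z ∧ y' r + d = y z := by
  have e₁ := hu.bounds_of_heapLT haz
  have e₂ := hu.bounds_of_heapLT hzb
  have p₁ := hv.le_column p
  have p₂ := hv.column_lt p
  have q₁ := hv.le_column q
  have q₂ := hv.column_lt q
  have p₃ := hv.lo_le p
  have q₃ := hv.le_hi q
  rw [ha] at e₁
  rw [hb] at e₂
  generalize hP : (v.get p : ℕ) = P at *
  generalize hQ : (v.get q : ℕ) = Q at *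
  have hpar := hu.parity z
  generalize hZ : (u.get z : ℕ) = Z at *
  have lo_left := (hv.lo_lipschitz c' (P - c') le_rfl (by omega)).2
  have hi_left := (hv.hi_lipschitz c' (Q - c') le_rfl (by omega)).1
  rw [Nat.add_sub_cancel' p₁] at lo_left
  rw [Nat.add_sub_cancel' q₁] at hi_left
  have hfirst := hv.first (by omega)
  have lo_right := (hv.lo_lipschitz P (c' + K' - 1 - P) p₁ (by omega)).1
  have hi_right := (hv.hi_lipschitz Q (c' + K' - 1 - Q) q₁ (by omega)).2
  rw [show P + (c' + K' - 1 - P) = c' + K' - 1 by omega] at lo_right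
  rw [show Q + (c' + K' - 1 - Q) = c' + K' - 1 by omega] at hi_right
  have hlast := hv.last (c' + K' - 1) (by omega) (by omega)
  have z₁ : c' ≤ Z := by
    by_contra hlt
    omega
  have z₂ : Z < c' + K' := by
    by_contra hlt
    omega
  refine hv.exists_pos Z z₁ z₂ (y z - d) ?_ ?_ ?_ |>.imp fun r hr => ⟨hr.1, by omega⟩
  · rcases le_total P Z with h | h
    · have := (hv.lo_lipschitz P (Z - P) p₁ (by omega)).1
      rw [Nat.add_sub_cancel' h] at this
      omega
    · have := (hv.lo_lipschitz Z (P - Z) z₁ (by omega)).2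
      rw [Nat.add_sub_cancel' h] at this
      omega
  · rcases le_total Q Z with h | h
    · have := (hv.hi_lipschitz Q (Z - Q) q₁ (by omega)).2
      rw [Nat.add_sub_cancel' h] at this
      omega
    · have := (hv.hi_lipschitz Z (Q - Z) z₁ (by omega)).1
      rw [Nat.add_sub_cancel' h] at this
      omega
  · omega

theorem convexSubheap_of_shift {v : List (Fin n)} {lo' hi' : ℕ → ℤ} {y' : Fin v.length → ℤ}
    {c' K' : ℕ} (hu : IsHeapShape u c K lo hi y) (hv : IsHeapShape v c' K' lo' hi' y')
    (hc : c ≤ c') (hK : c' + K' ≤ c + K) {d : ℤ} (hd : d % 2 = 0)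
    (h : ∀ j, c' ≤ j → j < c' + K' → lo j ≤ lo' j + d ∧ hi' j + d ≤ hi j) :
    ConvexSubheap v u := by
  have hex : ∀ p : Fin v.length, ∃ a : Fin u.length, (u.get a : ℕ) = v.get p ∧ y a = y' p + d := by
    intro p
    have p₁ := hv.le_column p
    have p₂ := hv.column_lt p
    have := h _ p₁ p₂
    have := hv.lo_le p
    have := hv.le_hi p
    have := hv.parity p
    exact hu.exists_pos _ (by omega) (by omega) _ (by omega) (by omega) (by omega)
  choose φ hφ hφ' using hex
  have hcol : ∀ p, u.get (φ p) = v.get p := fun p => Fin.ext (hφ p)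
  have hgen : ∀ p q, Adjacent (v.get p) (v.get q) → (p < q ↔ φ p < φ q) := by
    intro p q hpq
    rw [hv.lt_iff p q (Or.inr hpq), hu.lt_iff _ _ (Or.inr (by rwa [hcol, hcol])), hφ', hφ']
    omega
  have hmem : ∀ p q z, heapLT u (φ p) z → heapLT u z (φ q) → ∃ r, φ r = z := by
    intro p q z h₁ h₂
    obtain ⟨r, hr, hr'⟩ := hu.mem_of_between hv hd (hφ p) (hφ' p) (hφ q) (hφ' q) h₁ h₂
    exact ⟨r, hu.pos_ext ((hφ r).trans hr) ((hφ' r).trans hr')⟩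
  have hinj : Function.Injective φ := by
    intro p q hpq
    refine hv.pos_ext ?_ ?_
    · rw [← hφ, ← hφ, hpq]
    · have h₁ := hφ' p
      have h₂ := hφ' q
      rw [hpq] at h₁
      omega
  refine ⟨φ, hinj, hcol, fun p q => ⟨fun hpq => ?_, fun hpq => ?_⟩, hmem⟩
  · generalize ha : φ p = a at hpq
    induction hpq using Relation.TransGen.head_induction_on generalizing p with
    | single h' =>
      subst ha
      rw [hcol, hcol] at h'
      exact Relation.TransGen.single ⟨(hgen _ _ h'.2).2 h'.1, h'.2⟩
    | head h' hrest ih =>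
      subst ha
      obtain ⟨r, rfl⟩ := hmem p q _ (Relation.TransGen.single h') hrest
      rw [hcol, hcol] at h'
      exact Relation.TransGen.head ⟨(hgen _ _ h'.2).2 h'.1, h'.2⟩ (ih r rfl)
  · induction hpq with
    | single h' =>
      exact Relation.TransGen.single ⟨(hgen _ _ h'.2).1 h'.1, by rw [hcol, hcol]; exact h'.2⟩
    | tail _ h' ih =>
      exact Relation.TransGen.tail ih ⟨(hgen _ _ h'.2).1 h'.1, by rw [hcol, hcol]; exact h'.2⟩

/-- A convex embedding of a heap without empty columns is a translation. -/
theorem shift_of_convexSubheap {v : List (Fin n)} {lo' hi' : ℕ → ℤ} {y' : Fin v.length → ℤ}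
    {c' K' : ℕ} (hu : IsHeapShape u c K lo hi y) (hv : IsHeapShape v c' K' lo' hi' y')
    (hK : 0 < K') (hne : ∀ j, c' ≤ j → j < c' + K' → lo' j ≤ hi' j) (h : ConvexSubheap v u) :
    ∃ d : ℤ, ∀ j, c' ≤ j → j < c' + K' → lo j ≤ lo' j + d ∧ hi' j + d ≤ hi j := by
  obtain ⟨φ, hinj, hcol, hlt, hconv⟩ := h
  -- A covering pair of lattice points is mapped to a covering pair: otherwise an entry of the
  -- column of the lower point would lie strictly in between, and convexity would put it into the
  -- image of `φ`.
  have hcover : ∀ p q, Adjacent (v.get p) (v.get q) → y' q = y' p + 1 →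
      y (φ q) = y (φ p) + 1 := by
    intro p q hpq hy
    have h₁ := (hlt p q).2 (hv.heapLT_of_adjacent hpq (by omega))
    have h₂ := hu.bounds_of_heapLT h₁
    have hpq' : Adjacent (u.get (φ p)) (u.get (φ q)) := by rwa [hcol, hcol]
    by_contra hcon
    have h₃ := hu.parity (φ p)
    have h₄ := hu.parity (φ q)
    have h₅ := hu.lo_le (φ p)
    have h₆ := hu.le_hi (φ q)
    have p₁ := hu.le_column (φ p)
    have p₂ := hu.column_lt (φ p)
    have q₁ := hu.le_column (φ q)
    have q₂ := hu.column_lt (φ q)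
    have hhi : hi (u.get (φ q)) ≤ hi (u.get (φ p)) + 1 := by
      rcases hpq' with h' | h'
      · have := hu.hi_step (u.get (φ p)) p₁ (by omega)
        rw [← h']
        omega
      · have := hu.hi_step (u.get (φ q)) q₁ (by omega)
        rw [← h']
        omega
    have hadj := hpq'
    unfold Adjacent at hpq'
    obtain ⟨z, hz, hz'⟩ := hu.exists_pos (u.get (φ p)) p₁ p₂ (y (φ p) + 2) (by omega) (by omega)
      (by omega)
    have e₁ : heapLT u (φ p) z := hu.heapLT_of_eq hz.symm (by omega)
    have e₂ : heapLT u z (φ q) := by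
      refine hu.heapLT_of_adjacent ?_ (by omega)
      rwa [show u.get z = u.get (φ p) from Fin.ext hz]
    obtain ⟨r, rfl⟩ := hconv p q z e₁ e₂
    have f₁ := hv.bounds_of_heapLT ((hlt _ _).1 e₁)
    have f₂ := hv.bounds_of_heapLT ((hlt _ _).1 e₂)
    omega
  obtain ⟨p₀, hp₀, hy₀⟩ := hv.exists_pos c' le_rfl (by omega) (lo' c') le_rfl
    (hne c' le_rfl (by omega)) (hv.lo_parity c' le_rfl (by omega))
  have hshift : ∀ m, m < K' → ∀ p, (v.get p : ℕ) = c' + m →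
      y (φ p) - y' p = y (φ p₀) - y' p₀ := by
    intro m
    induction m with
    | zero =>
      intro _ p hp
      have h₁ := hv.first hK
      have h₂ := hv.lo_le p
      have h₃ := hv.le_hi p
      rw [hp, add_zero] at h₂ h₃
      obtain rfl : p = p₀ := hv.pos_ext (by omega) (by omega)
      rfl
    | succ m ih =>
      intro hm p hp
      have h₁ := hv.lo_step (c' + m) (by omega) (by omega)
      have h₂ := hv.hi_step (c' + m) (by omega) (by omega)
      have h₃ := hv.lo_le p
      have h₄ := hv.le_hi p
      have h₅ := hv.parity p
      have h₆ := hne (c' + m) (by omega) (by omega)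
      have h₇ := hv.hi_parity (c' + m) (by omega) (by omega)
      rw [hp, ← add_assoc] at h₃ h₄ h₅
      by_cases hle : y' p + 1 ≤ hi' (c' + m)
      · obtain ⟨q, hq, hq'⟩ := hv.exists_pos (c' + m) (by omega) (by omega) (y' p + 1) (by omega)
          hle (by push_cast at h₅ ⊢; omega)
        have := ih (by omega) q hq
        have := hcover p q (Or.inr (by omega)) hq'
        omega
      · obtain ⟨q, hq, hq'⟩ := hv.exists_pos (c' + m) (by omega) (by omega) (y' p - 1)
          (by push_cast at h₅ h₇ ⊢; omega) (by omega) (by push_cast at h₅ ⊢; omega)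
        have := ih (by omega) q hq
        have := hcover q p (Or.inl (by omega)) (by omega)
        omega
  refine ⟨y (φ p₀) - y' p₀, fun j h₁ h₂ => ?_⟩
  obtain ⟨p, hp, hp'⟩ := hv.exists_pos j h₁ h₂ (lo' j) le_rfl (hne j h₁ h₂) (hv.lo_parity j h₁ h₂)
  obtain ⟨q, hq, hq'⟩ := hv.exists_pos j h₁ h₂ (hi' j) (hne j h₁ h₂) le_rfl (hv.hi_parity j h₁ h₂)
  have e₁ := hshift (j - c') (by omega) p (by omega)
  have e₂ := hshift (j - c') (by omega) q (by omega)
  have e₃ := hu.lo_le (φ p)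
  have e₄ := hu.le_hi (φ q)
  rw [hcol, hp] at e₃
  rw [hcol, hq] at e₄
  omega

/-- A translation of the columns is compensated in the heights, to keep the parity condition. -/
theorem map {k n : ℕ} {v : List (Fin k)} {K : ℕ} {lo hi : ℕ → ℤ} {y : Fin v.length → ℤ}
    (hv : IsHeapShape v 0 K lo hi y) (f : Fin k → Fin n) (c : ℕ) (hf : ∀ i, (f i : ℕ) = c + i) :
    IsHeapShape (v.map f) c K (fun j => lo (j - c) + c) (fun j => hi (j - c) + c)
      fun p => y (p.cast (List.length_map f)) + c := by
  have hget : ∀ p : Fin (v.map f).length,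
      ((v.map f).get p : ℕ) = c + v.get (p.cast (List.length_map f)) := by
    intro p
    simp [hf]
  have hsub : ∀ j, c ≤ j → ∃ i, j = c + i := fun j hj => ⟨j - c, by omega⟩
  refine ⟨?_, ?_, ?_, ?_, ?_, ?_, ?_, ?_, ?_, ?_, ?_, ?_, ?_⟩
  · intro j h₁ h₂
    obtain ⟨i, rfl⟩ := hsub j h₁
    have := hv.lo_step i (by omega) (by omega)
    rw [show c + i + 1 - c = i + 1 by omega, show c + i - c = i by omega]
    omega
  · intro j h₁ h₂
    obtain ⟨i, rfl⟩ := hsub j h₁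
    have := hv.hi_step i (by omega) (by omega)
    rw [show c + i + 1 - c = i + 1 by omega, show c + i - c = i by omega]
    omega
  · intro h
    have := hv.first h
    simpa using this
  · intro j h₁ h₂
    obtain ⟨i, rfl⟩ := hsub j h₁
    have := hv.last i (by omega) (by omega)
    simpa using this
  · intro j h₁ h₂
    obtain ⟨i, rfl⟩ := hsub j h₁
    have := hv.lo_parity i (by omega) (by omega)
    rw [show c + i - c = i by omega]
    push_cast
    omega
  · intro j h₁ h₂
    obtain ⟨i, rfl⟩ := hsub j h₁
    have := hv.hi_parity i (by omega) (by omega)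
    rw [show c + i - c = i by omega]
    push_cast
    omega
  · intro p
    have := hv.parity (p.cast (List.length_map f))
    rw [hget]
    push_cast
    omega
  · intro p
    rw [hget]
    omega
  · intro p
    have := hv.column_lt (p.cast (List.length_map f))
    rw [hget]
    omega
  · intro p
    have := hv.lo_le (p.cast (List.length_map f))
    rw [hget, Nat.add_sub_cancel_left]
    omega
  · intro p
    have := hv.le_hi (p.cast (List.length_map f))
    rw [hget, Nat.add_sub_cancel_left]
    omega
  · intro j h₁ h₂ z h₃ h₄ h₅
    obtain ⟨i, rfl⟩ := hsub j h₁
    rw [show c + i - c = i by omega] at h₃ h₄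
    push_cast at h₅
    obtain ⟨p, hp, hp'⟩ := hv.exists_pos i (by omega) (by omega) (z - c) (by omega) (by omega)
      (by omega)
    refine ⟨p.cast (List.length_map f).symm, ?_, ?_⟩
    · rw [hget, ← hp]
      rfl
    · change y p + c = z
      omega
  · intro p q h
    have h' : v.get (p.cast (List.length_map f)) = v.get (q.cast (List.length_map f)) ∨
        Adjacent (v.get (p.cast (List.length_map f))) (v.get (q.cast (List.length_map f))) := by
      unfold Adjacent at h ⊢
      rw [Fin.ext_iff, hget, hget] at h
      rw [Fin.ext_iff]
      omega
    have := hv.lt_iff _ _ h'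
    rw [Fin.lt_def] at this ⊢
    simp only [Fin.val_cast] at this
    rw [this]
    omega

end IsHeapShape

/-! ### Heap containment in terms of lattice paths -/

theorem s_injective {n : ℕ} : Function.Injective (s : Fin n → Equiv.Perm (Fin (n + 1))) := by
  intro i j h
  have h₁ := congrArg Fin.val (DFunLike.congr_fun h i.castSucc)
  rw [s_castSucc, s_val] at h₁
  simp only [Fin.val_succ, Fin.val_castSucc] at h₁
  split_ifs at h₁ <;> exact Fin.ext (by omega)

theorem s_mul_s_eq_one_iff {n : ℕ} {i j : Fin n} : s i * s j = 1 ↔ i = j := by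
  refine ⟨fun h => s_injective ?_, fun h => by rw [h, s_mul_self]⟩
  rw [← s_inv j]
  exact eq_inv_of_mul_eq_one_left h

theorem s_mul_s_sq {n : ℕ} {i j : Fin n} : (s i * s j) ^ 2 = 1 ↔ ¬ Adjacent i j := by
  constructor
  · intro h hadj
    have hne : i ≠ j := by
      rintro rfl
      unfold Adjacent at hadj
      omega
    rw [pow_two, mul_assoc, ← s_braid hadj, ← mul_assoc (s i) (s i), s_mul_self, one_mul] at h
    exact hne (s_mul_s_eq_one_iff.1 h).symm
  · intro h
    rw [(s_commute h).mul_pow, pow_two, pow_two, s_mul_self, s_mul_self, one_mul]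

theorem s_mul_s_cube {n : ℕ} {i j : Fin n} :
    (s i * s j) ^ 3 = 1 ↔ i = j ∨ Adjacent i j := by
  by_cases hadj : Adjacent i j
  · refine iff_of_true ?_ (Or.inr hadj)
    have h₁ : (s i * s j) ^ 3 = (s i * (s j * s i)) * (s j * (s i * s j)) := by
      rw [pow_succ, pow_two]
      simp only [mul_assoc]
    rw [h₁, s_braid hadj]
    simp only [mul_assoc]
    rw [← mul_assoc (s j) (s j), s_mul_self, one_mul, ← mul_assoc (s i) (s i), s_mul_self, one_mul,
      s_mul_self]
  · rw [(s_commute hadj).mul_pow, pow_succ, pow_two, s_mul_self, one_mul, pow_succ, pow_two,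
      s_mul_self, one_mul, s_mul_s_eq_one_iff]
    tauto

/-- Orientation preserving Coxeter embeddings are the translations of the columns. -/
theorem isCoxeterEmbedding_iff {k n : ℕ} (hk : 0 < k) (f : Fin k → Fin n) :
    IsCoxeterEmbedding f ↔ ∃ c, ∀ i, (f i : ℕ) = c + i := by
  constructor
  · rintro ⟨hf, h⟩
    refine ⟨f ⟨0, hk⟩, ?_⟩
    rintro ⟨i, hi⟩
    induction i with
    | zero => rfl
    | succ i ih =>
      have h₁ := ih (by omega)
      have h₂ : f ⟨i, by omega⟩ < f ⟨i + 1, hi⟩ := hf (Fin.mk_lt_mk.2 (Nat.lt_succ_self i))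
      have h₃ := (h ⟨i, by omega⟩ ⟨i + 1, hi⟩ 3 (by simp)).1
        (s_mul_s_cube.2 (Or.inr (Or.inl rfl)))
      rw [s_mul_s_cube] at h₃
      have h₄ := h₃.resolve_left h₂.ne
      unfold Adjacent at h₄
      rw [Fin.lt_def] at h₂
      simp only at h₁ ⊢
      omega
  · rintro ⟨c, hc⟩
    have hadj : ∀ i j, Adjacent (f i) (f j) ↔ Adjacent i j := by
      intro i j
      unfold Adjacent
      rw [hc, hc]
      omega
    have hinj : ∀ i j, f i = f j ↔ i = j := by
      intro i j
      rw [Fin.ext_iff, Fin.ext_iff, hc, hc]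
      omega
    refine ⟨fun i j hij => ?_, fun i j m hm => ?_⟩
    · rw [Fin.lt_def] at hij ⊢
      rw [hc, hc]
      omega
    · rcases hm with rfl | rfl
      · rw [s_mul_s_sq, s_mul_s_sq, hadj]
      · rw [s_mul_s_cube, s_mul_s_cube, hadj, hinj]

theorem Avoids321.alternating {n : ℕ} {w : Equiv.Perm (Fin (n + 1))} (hw : Avoids321 w)
    {u : List (Fin n)} (hu : IsReducedWord w u) : Alternating u :=
  hw.braidFree.alternating hu

theorem Avoids321.exists_isHeapShape {n : ℕ} {w : Equiv.Perm (Fin (n + 1))} (hw : Avoids321 w)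
    {u : List (Fin n)} (hu : IsReducedWord w u) :
    ∃ y, IsHeapShape u 0 n (lower (steps w)) (upper (steps w)) y := by
  have := (hw.alternating hu).isHeapShape
  rw [hu.1] at this
  exact ⟨_, this⟩

theorem FullyCommutative.avoids321 {n : ℕ} {w : Equiv.Perm (Fin (n + 1))}
    (hw : FullyCommutative w) : Avoids321 w := by
  obtain ⟨u, hu⟩ := exists_isReducedWord w
  rw [← hu.1]
  exact (hw.braidFree.alternating hu).avoids321

theorem upper_steps_parity {n : ℕ} (w : Equiv.Perm (Fin (n + 1))) {j : ℕ} (hj : j < n) :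
    (upper (steps w) j - j) % 2 = 0 := by
  have := sumFst_parity (steps w) (j + 1) (by simpa using hj)
  rw [upper]
  push_cast at this
  omega

/-- Heap containment of a permutation without empty columns: a translate of its region of lattice
points is contained in the region of `w`. -/
theorem heapContains_iff {n k : ℕ} {w : Equiv.Perm (Fin (n + 1))} {h : Equiv.Perm (Fin (k + 1))}
    (hw : Avoids321 w) (hh : Avoids321 h) (hk : 0 < k)
    (hne : ∀ j, j < k → lower (steps h) j ≤ upper (steps h) j) :
    HeapContains w h ↔ ∃ (c : ℕ) (d : ℤ), c + k ≤ n ∧ ∀ j, j < k →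
      lower (steps w) (c + j) ≤ lower (steps h) j + d ∧
      upper (steps h) j + d ≤ upper (steps w) (c + j) := by
  constructor
  · rintro ⟨u, v, f, hu, hv, hf, hsub⟩
    obtain ⟨c, hc⟩ := (isCoxeterEmbedding_iff hk f).1 hf
    obtain ⟨y, hy⟩ := hw.exists_isHeapShape hu
    obtain ⟨y', hy'⟩ := hh.exists_isHeapShape hv
    obtain ⟨d, hd⟩ := hy.shift_of_convexSubheap (hy'.map f c hc) hk (fun j h₁ h₂ => by
      have := hne (j - c) (by omega)
      omega) hsub
    refine ⟨c, d + c, ?_, fun j hj => ?_⟩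
    · have h₁ := hc ⟨k - 1, by omega⟩
      have h₂ := (f ⟨k - 1, by omega⟩).2
      simp only at h₁
      omega
    · have := hd (c + j) (by omega) (by omega)
      rw [Nat.add_sub_cancel_left] at this
      omega
  · rintro ⟨c, d, hcn, hd⟩
    have hd' : ∃ d : ℤ, (d - c) % 2 = 0 ∧ ∀ j, j < k →
        lower (steps w) (c + j) ≤ lower (steps h) j + d ∧
        upper (steps h) j + d ≤ upper (steps w) (c + j) := by
      by_cases hpar : (d - c) % 2 = 0
      · exact ⟨d, hpar, hd⟩
      · refine ⟨d + 1, by omega, fun j hj => ?_⟩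
        have h₁ := hd j hj
        have h₂ := upper_steps_parity w (j := c + j) (by omega)
        have h₃ := upper_steps_parity h hj
        push_cast at h₂
        omega
    clear hd d
    obtain ⟨d, hpar, hd⟩ := hd'
    obtain ⟨u, hu⟩ := exists_isReducedWord w
    obtain ⟨v, hv⟩ := exists_isReducedWord h
    obtain ⟨y, hy⟩ := hw.exists_isHeapShape hu
    obtain ⟨y', hy'⟩ := hh.exists_isHeapShape hv
    have hc : ∀ i : Fin k, ((⟨c + i, by omega⟩ : Fin n) : ℕ) = c + i := fun i => rfl
    refine ⟨u, v, fun i => ⟨c + i, by omega⟩, hu, hv, (isCoxeterEmbedding_iff hk _).2 ⟨c, hc⟩, ?_⟩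
    refine hy.convexSubheap_of_shift (hy'.map _ c hc) (Nat.zero_le c) (by omega) (d := d - c) hpar
      fun j h₁ h₂ => ?_
    have := hd (j - c) (by omega)
    rw [Nat.add_sub_cancel' h₁] at this
    omega

/-! ### The heap of the diamond reduction -/

/-- A converse of `Alternating.isHeapShape`, for arbitrary lattice paths: the point just above the
lower one of two points of a column lies in the neighbouring column as well. -/
theorem alternating_of_isHeapShape {k : ℕ} {v : List (Fin k)} {lo hi : ℕ → ℤ}
    {y : Fin v.length → ℤ} (h : IsHeapShape v 0 k lo hi y) : Alternating v := by
  rintro a b c x hv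
  have hlen : v.length = a.length + (b.length + (c.length + 1) + 1) := by rw [hv]; simp
  let p : Fin v.length := ⟨a.length, by omega⟩
  let q : Fin v.length := ⟨a.length + 1 + b.length, by omega⟩
  have hp : v.get p = x := by simp [p, hv]
  have hq : v.get q = x := by
    simp only [List.get_eq_getElem, q, hv]
    rw [List.getElem_append_right (by omega)]
    simp [show a.length + 1 + b.length - a.length = b.length + 1 by omega]
  have hpq : p < q := by
    rw [Fin.lt_def]
    simp only [p, q]
    omega
  have hy := (h.lt_iff p q (Or.inl (hp.trans hq.symm))).1 hpq
  have h₁ := h.lo_le p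
  have h₂ := h.le_hi q
  have h₃ := h.parity p
  have h₄ := h.parity q
  rw [hp] at h₁ h₃
  rw [hq] at h₂ h₄
  -- The entry of a neighbouring column just above the lower one of the two entries.
  have key : ∀ j : ℕ, j < k → ((x : ℕ) + 1 = j ∨ j + 1 = (x : ℕ)) → lo j ≤ lo x + 1 →
      hi x - 1 ≤ hi j → ∃ z ∈ b, (z : ℕ) = j := by
    intro j hj hadj hlo hhi
    obtain ⟨r, hr, hr'⟩ := h.exists_pos j (Nat.zero_le j) (by omega) (y p + 1) (by omega)
      (by omega) (by omega)
    have hpr : p < r := (h.lt_iff p r (Or.inr (by unfold Adjacent; rw [hp, hr]; omega))).2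
      (by omega)
    have hrq : r < q := (h.lt_iff r q (Or.inr (by unfold Adjacent; rw [hq, hr]; omega))).2
      (by omega)
    rw [Fin.lt_def] at hpr hrq
    simp only [p, q] at hpr hrq
    refine ⟨v.get r, ?_, hr⟩
    have hget : v.get r = b[(r : ℕ) - a.length - 1]'(by omega) := by
      simp only [List.get_eq_getElem, hv]
      rw [List.getElem_append_right (by omega), List.getElem_cons, dif_neg (by omega),
        List.getElem_append_left (by omega)]
    rw [hget]
    exact List.getElem_mem _
  constructor
  · have h0 : (x : ℕ) ≠ 0 := by
      intro h0
      have := h.first (by omega)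
      rw [h0] at h₁ h₂
      omega
    obtain ⟨j, hj⟩ := Nat.exists_eq_succ_of_ne_zero h0
    have e₁ := h.lo_step j (Nat.zero_le j) (by omega)
    have e₂ := h.hi_step j (Nat.zero_le j) (by omega)
    rw [Nat.succ_eq_add_one] at hj
    obtain ⟨z, hz, hz'⟩ := key j (by omega) (by omega) (by rw [hj]; omega) (by rw [hj]; omega)
    exact ⟨z, hz, by omega⟩
  · have hlast : (x : ℕ) + 1 ≠ k := by
      intro hlast
      have := h.last x (Nat.zero_le _) (by omega)
      omega
    have e₁ := h.lo_step x (Nat.zero_le _) (by omega)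
    have e₂ := h.hi_step x (Nat.zero_le _) (by omega)
    exact key _ (by omega) (by omega) (by omega) (by omega)

namespace IsHeapShape

section Diamond

variable {n : ℕ} {u : List (Fin n)} {lo hi : ℕ → ℤ} {y : Fin u.length → ℤ}

/-- The two points of a minimal diamond in its central column are consecutive. -/
theorem diamond_top (h : IsHeapShape u 0 n lo hi y) (D : MinimalDiamond u) :
    y D.top = y D.bot + 2 := by
  have h₁ := h.bounds_of_heapLT D.bot_lt_top
  have h₂ := h.parity D.bot
  have h₃ := h.parity D.top
  have h₄ := h.lo_le D.bot
  have h₅ := h.le_hi D.top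
  have hc := D.same_column
  rw [← hc] at h₃ h₅
  by_contra hne
  obtain ⟨z, hz, hz'⟩ := h.exists_pos (u.get D.bot) (Nat.zero_le _) (by omega) (y D.bot + 2)
    (by omega) (by omega) (by omega)
  exact D.minimal z (h.heapLT_of_eq hz.symm (by omega))
    (h.heapLT_of_eq (hz.trans (congrArg Fin.val hc)) (by omega)) (Fin.ext hz)

theorem diamond_left (h : IsHeapShape u 0 n lo hi y) (D : MinimalDiamond u) :
    y D.left = y D.bot + 1 := by
  have h₁ := h.bounds_of_heapLT D.bot_lt_left
  have h₂ := h.bounds_of_heapLT D.left_lt_top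
  have h₃ := h.diamond_top D
  omega

theorem diamond_right (h : IsHeapShape u 0 n lo hi y) (D : MinimalDiamond u) :
    y D.right = y D.bot + 1 := by
  have h₁ := h.bounds_of_heapLT D.bot_lt_right
  have h₂ := h.bounds_of_heapLT D.right_lt_top
  have h₃ := h.diamond_top D
  omega

theorem diamond_ext (h : IsHeapShape u 0 n lo hi y) {D D' : MinimalDiamond u}
    (hD : D.bot = D'.bot) : D = D' := by
  have e₁ : D.left = D'.left := by
    refine h.pos_ext ?_ ?_
    · have h₁ := D.left_column
      have h₂ := D'.left_column
      rw [hD] at h₁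
      omega
    · rw [h.diamond_left, h.diamond_left, hD]
  have e₂ : D.right = D'.right := by
    refine h.pos_ext ?_ ?_
    · rw [D.right_column, D'.right_column, hD]
    · rw [h.diamond_right, h.diamond_right, hD]
  have e₃ : D.top = D'.top := by
    refine h.pos_ext ?_ ?_
    · rw [← D.same_column, ← D'.same_column, hD]
    · rw [h.diamond_top, h.diamond_top, hD]
  cases D
  cases D'
  simp only at hD e₁ e₂ e₃
  subst hD e₁ e₂ e₃
  rfl

theorem exists_diamond (h : IsHeapShape u 0 n lo hi y) {j : ℕ} (h₀ : 0 < j) (hj : j + 1 < n)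
    {z : ℤ} (h₁ : lo j ≤ z) (h₂ : z + 2 ≤ hi j) (h₃ : (z - j) % 2 = 0) :
    ∃ D : MinimalDiamond u, (D.column : ℕ) = j ∧ y D.bot = z := by
  obtain ⟨i, rfl⟩ := Nat.exists_eq_succ_of_ne_zero h₀.ne'
  rw [Nat.succ_eq_add_one] at *
  have a₁ := h.lo_step i (Nat.zero_le i) (by omega)
  have a₂ := h.hi_step i (Nat.zero_le i) (by omega)
  have a₃ := h.lo_step (i + 1) (Nat.zero_le _) (by omega)
  have a₄ := h.hi_step (i + 1) (Nat.zero_le _) (by omega)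
  push_cast at h₃
  obtain ⟨b, hb, hb'⟩ := h.exists_pos (i + 1) (Nat.zero_le _) (by omega) z h₁ (by omega)
    (by push_cast; omega)
  obtain ⟨t, ht, ht'⟩ := h.exists_pos (i + 1) (Nat.zero_le _) (by omega) (z + 2) (by omega) h₂
    (by push_cast; omega)
  obtain ⟨l, hl, hl'⟩ := h.exists_pos i (Nat.zero_le _) (by omega) (z + 1) (by omega) (by omega)
    (by omega)
  obtain ⟨r, hr, hr'⟩ := h.exists_pos (i + 1 + 1) (Nat.zero_le _) (by omega) (z + 1) (by omega)
    (by omega) (by push_cast; omega)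
  refine ⟨⟨b, l, r, t, Fin.ext (hb.trans ht.symm), h.heapLT_of_eq (hb.trans ht.symm) (by omega),
    ?_, by omega, by omega, ?_, ?_, ?_, ?_⟩, hb, hb'⟩
  · intro x hx hx' hcol
    have e₁ := h.bounds_of_heapLT hx
    have e₂ := h.bounds_of_heapLT hx'
    have e₃ := h.parity x
    rw [hcol] at e₃
    omega
  · exact h.heapLT_of_adjacent (by unfold Adjacent; omega) (by omega)
  · exact h.heapLT_of_adjacent (by unfold Adjacent; omega) (by omega)
  · exact h.heapLT_of_adjacent (by unfold Adjacent; omega) (by omega)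
  · exact h.heapLT_of_adjacent (by unfold Adjacent; omega) (by omega)

/-- A lower diamond shares one of its two upper edges with a higher one, for which this is a lower
edge. -/
theorem edgeBelow_iff (h : IsHeapShape u 0 n lo hi y) {D D' : MinimalDiamond u} :
    D.EdgeBelow D' ↔ Adjacent D.column D'.column ∧ y D'.bot = y D.bot + 1 := by
  have b₁ := D.left_column
  have b₂ := D.right_column
  have b₃ := congrArg Fin.val D.same_column
  have b₄ := h.diamond_left D
  have b₅ := h.diamond_right D
  have b₆ := h.diamond_top D
  have c₁ := D'.left_column
  have c₂ := D'.right_column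
  have c₃ := congrArg Fin.val D'.same_column
  have c₄ := h.diamond_left D'
  have c₅ := h.diamond_right D'
  have c₆ := h.diamond_top D'
  unfold MinimalDiamond.EdgeBelow Adjacent MinimalDiamond.column
  constructor
  · rintro ⟨⟨⟨a, b⟩, h₁, h₂⟩, h₃⟩
    have h₄ := h.bounds_of_heapLT h₃
    simp only [MinimalDiamond.edges, Set.mem_insert_iff, Set.mem_singleton_iff,
      Prod.mk.injEq] at h₁ h₂
    rcases h₁ with ⟨rfl, rfl⟩ | ⟨rfl, rfl⟩ | ⟨rfl, rfl⟩ | ⟨rfl, rfl⟩ <;>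
    rcases h₂ with ⟨e₁, e₂⟩ | ⟨e₁, e₂⟩ | ⟨e₁, e₂⟩ | ⟨e₁, e₂⟩ <;>
    · have f₁ := congrArg y e₁
      have f₂ := congrArg (fun p => (u.get p : ℕ)) e₁
      have f₃ := congrArg (fun p => (u.get p : ℕ)) e₂
      omega
  · rintro ⟨h₁ | h₁, h₂⟩
    · have e₁ : D.right = D'.bot := h.pos_ext (by omega) (by omega)
      have e₂ : D.top = D'.left := h.pos_ext (by omega) (by omega)
      refine ⟨⟨(D.right, D.top), ?_, ?_⟩, e₁ ▸ D.bot_lt_right⟩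
      · simp [MinimalDiamond.edges]
      · simp [MinimalDiamond.edges, e₁, e₂]
    · have e₁ : D.left = D'.bot := h.pos_ext (by omega) (by omega)
      have e₂ : D.top = D'.right := h.pos_ext (by omega) (by omega)
      refine ⟨⟨(D.left, D.top), ?_, ?_⟩, e₁ ▸ D.bot_lt_left⟩
      · simp [MinimalDiamond.edges]
      · simp [MinimalDiamond.edges, e₁, e₂]

end Diamond

/-- The centers of the minimal diamonds of `u` form a heap whose region is obtained by removing the
outermost columns and the boundary paths of the region of `u`. -/
theorem diamondReduction {k : ℕ} {u : List (Fin (k + 2))} {lo hi : ℕ → ℤ} {y : Fin u.length → ℤ}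
    (h : IsHeapShape u 0 (k + 2) lo hi y) {v : List (Fin k)} (e : Fin v.length ≃ MinimalDiamond u)
    (hcol : ∀ p, ((e p).column : ℕ) = (v.get p : ℕ) + 1)
    (hlt : ∀ p q, heapLT v p q ↔ Relation.TransGen MinimalDiamond.EdgeBelow (e p) (e q)) :
    IsHeapShape v 0 k (fun j => lo (j + 1) + 1) (fun j => hi (j + 1) - 1)
      fun p => y (e p).bot + 1 := by
  have hbelow : ∀ D D' : MinimalDiamond u, Relation.TransGen MinimalDiamond.EdgeBelow D D' →
      y D.bot < y D'.bot := by
    intro D D' hD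
    induction hD with
    | single h' => have := (h.edgeBelow_iff.1 h').2; omega
    | tail _ h' ih => have := (h.edgeBelow_iff.1 h').2; omega
  have hpos : ∀ p q : Fin v.length, heapLT v p q → p < q := by
    intro p q hpq
    induction hpq with
    | single h' => exact h'.1
    | tail _ h' ih => exact ih.trans h'.1
  have hbot : ∀ p, (u.get (e p).bot : ℕ) = v.get p + 1 := hcol
  have hlo : ∀ p, lo (v.get p + 1) ≤ y (e p).bot := fun p => by
    have := h.lo_le (e p).bot
    rwa [hbot] at this
  have hhi : ∀ p, y (e p).bot + 2 ≤ hi (v.get p + 1) := fun p => by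
    have := h.le_hi (e p).top
    rwa [← (e p).same_column, hbot, h.diamond_top] at this
  have hpar : ∀ p, (y (e p).bot + 1 - (v.get p : ℕ)) % 2 = 0 := fun p => by
    have := h.parity (e p).bot
    rw [hbot] at this
    push_cast at this
    omega
  have hfirst : 0 < k → hi (0 + 1) - 1 ≤ lo (0 + 1) + 1 := by
    intro hk
    have h₁ := h.first (by omega)
    have h₂ := h.lo_step 0 le_rfl (by omega)
    have h₃ := h.hi_step 0 le_rfl (by omega)
    omega
  have hlast : ∀ j, 0 ≤ j → j + 1 = 0 + k → hi (j + 1) - 1 ≤ lo (j + 1) + 1 := by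
    intro j _ hj
    have h₁ := h.last (j + 1 + 1) (by omega) (by omega)
    have h₂ := h.lo_step (j + 1) (by omega) (by omega)
    have h₃ := h.hi_step (j + 1) (by omega) (by omega)
    omega
  have hex : ∀ j, 0 ≤ j → j < 0 + k → ∀ z : ℤ, lo (j + 1) + 1 ≤ z → z ≤ hi (j + 1) - 1 →
      (z - j) % 2 = 0 → ∃ p, (v.get p : ℕ) = j ∧ y (e p).bot + 1 = z := by
    intro j _ hj z h₁ h₂ h₃
    obtain ⟨D, hD, hD'⟩ := h.exists_diamond (j := j + 1) (by omega) (by omega) (z := z - 1)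
      (by omega) (by omega) (by push_cast; omega)
    refine ⟨e.symm D, ?_, ?_⟩
    · have := hcol (e.symm D)
      rw [e.apply_symm_apply, hD] at this
      omega
    · rw [e.apply_symm_apply, hD']
      omega
  have hadj : ∀ p q, Adjacent (v.get p) (v.get q) → p < q → y (e p).bot < y (e q).bot :=
    fun p q hc hpq => hbelow _ _ ((hlt p q).1 (Relation.TransGen.single ⟨hpq, hc⟩))
  have hadj' : ∀ p q, Adjacent (v.get p) (v.get q) → (p < q ↔ y (e p).bot < y (e q).bot) := by
    intro p q hc
    refine ⟨hadj p q hc, fun hy => ?_⟩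
    rcases lt_trichotomy p q with h' | rfl | h'
    · exact h'
    · exact absurd hy (lt_irrefl _)
    · exact absurd (hadj q p hc.symm h') (not_lt.2 hy.le)
  have hsame : ∀ p q, v.get p = v.get q → y (e p).bot < y (e q).bot → p < q := by
    intro p q hc hy
    have h₁ := hlo p
    have h₂ := hhi q
    have h₃ := hpar p
    have h₄ := hpar q
    rw [← hc] at h₂ h₄
    by_cases hk : (v.get p : ℕ) + 1 = k
    · have := hlast _ (Nat.zero_le _) (hk.trans (zero_add k).symm)
      omega
    have a₁ := h.lo_step (v.get p + 1) (by omega) (by omega)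
    have a₂ := h.hi_step (v.get p + 1) (by omega) (by omega)
    obtain ⟨r, hr, hr'⟩ := hex (v.get p + 1) (Nat.zero_le _) (by omega) (y (e p).bot + 2)
      (by omega) (by omega) (by push_cast; omega)
    exact ((hadj' p r (by unfold Adjacent; omega)).2 (by omega)).trans
      ((hadj' r q (by unfold Adjacent; rw [← hc]; omega)).2 (by omega))
  refine ⟨?_, ?_, hfirst, hlast, ?_, ?_, hpar, fun _ => Nat.zero_le _, fun p => ?_, ?_, ?_, hex, ?_⟩
  · intro j _ hj
    have := h.lo_step (j + 1) (by omega) (by omega)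
    omega
  · intro j _ hj
    have := h.hi_step (j + 1) (by omega) (by omega)
    omega
  · intro j _ hj
    have := h.lo_parity (j + 1) (by omega) (by omega)
    push_cast at this
    omega
  · intro j _ hj
    have := h.hi_parity (j + 1) (by omega) (by omega)
    push_cast at this
    omega
  · rw [zero_add]; exact (v.get p).2
  · intro p
    have := hlo p
    omega
  · intro p
    have := hhi p
    omega
  · rintro p q (hc | hc)
    · refine ⟨fun hpq => ?_, fun hy => hsame p q hc (by omega)⟩
      rcases lt_trichotomy (y (e p).bot) (y (e q).bot) with h' | h' | h'
      · omega
      · have : e p = e q := h.diamond_ext (h.pos_ext (by rw [hbot, hbot, hc]) h')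
        exact absurd (e.injective this) hpq.ne
      · exact absurd (hsame q p hc.symm h') (not_lt.2 hpq.le)
    · rw [hadj' p q hc]
      omega

end IsHeapShape

theorem Avoids321.upper_sub_lower {n : ℕ} {w : Equiv.Perm (Fin (n + 1))} (hw : Avoids321 w)
    {u : List (Fin n)} (hu : IsReducedWord w u) {j : ℕ} (hj : j < n) :
    upper (steps w) j - lower (steps w) j = 2 * colCount j u - 2 := by
  have := (hw.alternating hu).upper_sub_lower hj
  rwa [hu.1] at this

theorem mem_supp_iff {n : ℕ} {w : Equiv.Perm (Fin (n + 1))} (hw : Avoids321 w) {i : Fin n} :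
    i ∈ supp w ↔ lower (steps w) i ≤ upper (steps w) i := by
  constructor
  · rintro ⟨u, hu, hi⟩
    have h₁ := hw.upper_sub_lower hu i.2
    have h₂ : colCount (i : ℕ) u ≠ 0 := fun h => colCount_eq_zero.1 h i hi rfl
    have h₃ := colCount_nonneg (i : ℕ) u
    omega
  · intro h
    obtain ⟨u, hu⟩ := exists_isReducedWord w
    have h₁ := hw.upper_sub_lower hu i.2
    have h₂ : colCount (i : ℕ) u ≠ 0 := by omega
    rw [Ne, colCount_eq_zero] at h₂
    push Not at h₂
    obtain ⟨x, hx, hxi⟩ := h₂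
    exact ⟨u, hu, Fin.ext hxi ▸ hx⟩

theorem connected_iff {n : ℕ} {w : Equiv.Perm (Fin (n + 1))} (hw : Avoids321 w) :
    Connected w ↔ 0 < n ∧ ∀ j, j < n → lower (steps w) j ≤ upper (steps w) j := by
  unfold Connected
  constructor
  · rintro ⟨⟨i, -⟩, h⟩
    refine ⟨i.pos, fun j hj => ?_⟩
    exact (mem_supp_iff hw (i := ⟨j, hj⟩)).1 (h ▸ Set.mem_univ _)
  · rintro ⟨hn, h⟩
    have : supp w = Set.univ := Set.eq_univ_of_forall fun i => (mem_supp_iff hw).2 (h i i.2)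
    exact ⟨⟨⟨0, hn⟩, this ▸ Set.mem_univ _⟩, this⟩

/-- The diamond reduction of `h` avoids `321`, has no empty column, and its lattice paths are those
of `h` moved towards each other by one, up to a translation. -/
theorem exists_shift_of_isDiamondReduction {k : ℕ} (hk : 1 ≤ k)
    {h : Equiv.Perm (Fin (k + 2 + 1))} {g : Equiv.Perm (Fin (k + 1))} (hh : Avoids321 h)
    (htwo : TwoInInternalColumns h) (hg : IsDiamondReduction h g) :
    Avoids321 g ∧ (∀ j, j < k → lower (steps g) j ≤ upper (steps g) j) ∧
      ∃ d : ℤ, ∀ j, j < k → lower (steps g) j = lower (steps h) (j + 1) + 1 + d ∧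
        upper (steps g) j = upper (steps h) (j + 1) - 1 + d := by
  obtain ⟨u, v, hu, hv, e, hcol, hlt⟩ := hg
  obtain ⟨y, hy⟩ := hh.exists_isHeapShape hu
  have hshape := hy.diamondReduction e hcol hlt
  have hg321 : Avoids321 g := hv.1 ▸ (alternating_of_isHeapShape hshape).avoids321
  have hne : ∀ j, j < k → lower (steps h) (j + 1) + 1 ≤ upper (steps h) (j + 1) - 1 := by
    intro j hj
    have h₁ := hh.upper_sub_lower hu (j := j + 1) (by omega)
    have h₂ := htwo u hu ⟨j + 1, by omega⟩ (Nat.succ_pos j) (by simp only; omega)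
    have h₃ : (2 : ℤ) ≤ colCount (j + 1) u := by
      unfold colCount
      rw [List.count] at h₂
      have h₄ : u.countP (fun x : Fin (k + 2) => decide ((x : ℕ) = j + 1)) =
          u.countP (fun x => x == (⟨j + 1, by omega⟩ : Fin (k + 2))) := by
        congr 1
        funext x
        rw [Bool.eq_iff_iff]
        simp [Fin.ext_iff]
      rw [h₄]
      exact_mod_cast h₂
    omega
  obtain ⟨y', hy'⟩ := hg321.exists_isHeapShape hv
  have hself : ConvexSubheap v v :=
    ⟨id, Function.injective_id, fun _ => rfl, fun _ _ => Iff.rfl, fun _ _ y _ _ => ⟨y, rfl⟩⟩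
  obtain ⟨d, hd⟩ := hy'.shift_of_convexSubheap hshape hk
    (fun j _ hj => hne j (by omega)) hself
  have hne' : ∀ j, j < k → lower (steps g) j ≤ upper (steps g) j := by
    intro j hj
    have := hd j (Nat.zero_le j) (by omega)
    have := hne j hj
    omega
  obtain ⟨d', hd'⟩ := hshape.shift_of_convexSubheap hy' hk
    (fun j _ hj => hne' j (by omega)) hself
  refine ⟨hg321, hne', d, fun j hj => ?_⟩
  have h₀ := hd 0 le_rfl (by omega)
  have h₀' := hd' 0 le_rfl (by omega)
  have h₁ := hd j (Nat.zero_le j) (by omega)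
  have h₁' := hd' j (Nat.zero_le j) (by omega)
  omega

/-! ### Permutations avoiding `321` as pairs of lattice paths -/

/-- The two lattice paths encoded by `P`, started with height difference `t`, do not cross and end
at the same height. -/
def GoodFrom : ℤ → List (Bool × Bool) → Prop
  | t, [] => t = 0
  | t, a :: P => 0 ≤ t ∧ GoodFrom (t + sgn a.1 - sgn a.2) P

theorem sumFst_cons (a : Bool × Bool) (P : List (Bool × Bool)) (j : ℕ) :
    sumFst (a :: P) (j + 1) = sgn a.1 + sumFst P j := by
  simp [sumFst]

theorem sumSnd_cons (a : Bool × Bool) (P : List (Bool × Bool)) (j : ℕ) :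
    sumSnd (a :: P) (j + 1) = sgn a.2 + sumSnd P j := by
  simp [sumSnd]

theorem goodFrom_iff (t : ℤ) (P : List (Bool × Bool)) :
    GoodFrom t P ↔ (∀ j, j ≤ P.length → 0 ≤ t + sumFst P j - sumSnd P j) ∧
      t + sumFst P P.length - sumSnd P P.length = 0 := by
  induction P generalizing t with
  | nil =>
    simp only [GoodFrom, List.length_nil, sumFst_zero, sumSnd_zero]
    refine ⟨fun h => ⟨fun j hj => ?_, by omega⟩, fun h => by omega⟩
    obtain rfl : j = 0 := by omega
    rw [sumFst_zero, sumSnd_zero]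
    omega
  | cons a P ih =>
    rw [GoodFrom, ih, List.length_cons, sumFst_cons, sumSnd_cons]
    constructor
    · rintro ⟨h₁, h₂, h₃⟩
      refine ⟨fun j hj => ?_, by omega⟩
      cases j with
      | zero => simpa using h₁
      | succ j =>
        have := h₂ j (by omega)
        rw [sumFst_cons, sumSnd_cons]
        omega
    · rintro ⟨h₁, h₂⟩
      refine ⟨by simpa using h₁ 0 (Nat.zero_le _), fun j hj => ?_, by omega⟩
      have := h₁ (j + 1) (by omega)
      rw [sumFst_cons, sumSnd_cons] at this
      omega

theorem Avoids321.goodFrom_steps {n : ℕ} {w : Equiv.Perm (Fin (n + 1))} (hw : Avoids321 w) :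
    GoodFrom 0 (steps w) := by
  classical
  obtain ⟨u, hu⟩ := exists_isReducedWord w
  have halt := hw.alternating hu
  have key : ∀ j, j < n → 0 ≤ sumFst (steps w) (j + 1) - sumSnd (steps w) (j + 1) ∧
      (j + 1 = n → sumFst (steps w) (j + 1) - sumSnd (steps w) (j + 1) = 0) := by
    intro j hj
    have h₁ := hw.upper_sub_lower hu hj
    have h₂ := lower_steps_succ halt hj
    rw [hu.1, lower] at h₂
    rw [upper] at h₁
    have h₃ := colCount_nonneg j u
    have h₆ := Alternating.prefix_bounds j (u := u) (v := []) (by simpa using halt)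
    rw [List.append_nil] at h₆
    have h₇ : j + 1 = n → colCount (j + 1) u = 0 := fun hj =>
      colCount_eq_zero.2 fun x _ => by have := x.2; omega
    split_ifs at h₂ with hf
    · obtain ⟨t₁, x, t₂, h₄, hx, -⟩ := firstLeft_iff.1 hf
      have h₅ : colCount j u ≠ 0 := fun h => colCount_eq_zero.1 h x (by simp [h₄]) hx
      have := h₆.1 hf
      rw [← lower] at *
      exact ⟨by omega, fun hn => by have := h₇ hn; omega⟩
    · have := h₆.2 hf
      rw [← lower] at *
      exact ⟨by omega, fun hn => by have := h₇ hn; omega⟩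
  rw [goodFrom_iff, length_steps]
  constructor
  · intro j hj
    cases j with
    | zero => simp
    | succ j => have := (key j (by omega)).1; omega
  · cases n with
    | zero => simp
    | succ n => have := (key n (by omega)).2 rfl; omega

/-- A permutation avoiding `321` is increasing on its excedances and on its other positions. -/
theorem Avoids321.lt_of_iff {n : ℕ} {w : Equiv.Perm (Fin (n + 1))} (hw : Avoids321 w)
    {x y : Fin (n + 1)} (hxy : x < y) (h : x < w x ↔ y < w y) : w x < w y := by
  obtain ⟨u, hu⟩ := exists_isReducedWord w
  have halt := hw.alternating hu
  by_contra hlt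
  have hlt' : w y < w x := lt_of_le_of_ne (not_lt.1 hlt) fun h' => hxy.ne' (w.injective h')
  rw [← hu.1] at hlt' h
  obtain ⟨h₁, h₂⟩ := halt.lt_and_lt_of_inversion hxy hlt'
  exact lt_asymm h₂ (h.1 h₁)

/-- Two permutations that map `E` to `V` and are increasing on `E` and on its complement agree: at
the first place where they differ, the one with the larger value has skipped a value. -/
theorem perm_eq_of_strictMonoOn {m : ℕ} {f g : Equiv.Perm (Fin m)} (E V : Fin m → Prop)
    (hf : ∀ x, V (f x) ↔ E x) (hg : ∀ x, V (g x) ↔ E x)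
    (hfm : ∀ x y, x < y → (E x ↔ E y) → f x < f y)
    (hgm : ∀ x y, x < y → (E x ↔ E y) → g x < g y) : f = g := by
  have key : ∀ (f g : Equiv.Perm (Fin m)), (∀ x, V (f x) ↔ E x) → (∀ x, V (g x) ↔ E x) →
      (∀ x y, x < y → (E x ↔ E y) → g x < g y) → ∀ x, (∀ y, y < x → f y = g y) →
      ¬ f x < g x := by
    intro f g hf hg hgm x ih hlt
    have hy : g (g.symm (f x)) = f x := g.apply_symm_apply _
    generalize g.symm (f x) = y at hy
    have hE : E x ↔ E y := by rw [← hf, ← hg, hy]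
    rcases lt_trichotomy x y with h | rfl | h
    · have := hgm x y h hE
      rw [hy] at this
      exact lt_asymm this hlt
    · exact hlt.ne hy.symm
    · have := ih y h
      rw [hy] at this
      exact h.ne (f.injective this)
  ext x
  congr 1
  induction x using WellFoundedLT.induction with
  | _ x ih =>
    rcases lt_trichotomy (f x) (g x) with h | h | h
    · exact absurd h (key f g hf hg hgm x ih)
    · exact h
    · exact absurd h (key g f hg hf hfm x fun y hy => (ih y hy).symm)

theorem steps_injOn {n : ℕ} {w w' : Equiv.Perm (Fin (n + 1))} (hw : Avoids321 w)
    (hw' : Avoids321 w') (h : steps w = steps w') : w = w' := by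
  have hsteps : ∀ i : Fin n, (i.castSucc < w i.castSucc ↔ i.castSucc < w' i.castSucc) ∧
      (w⁻¹ i.succ < i.succ ↔ w'⁻¹ i.succ < i.succ) := by
    intro i
    have := congrFun (List.ofFn_injective h) i
    simpa using this
  have hE : ∀ x, x < w x ↔ x < w' x := by
    intro x
    refine Fin.lastCases ?_ (fun i => (hsteps i).1) x
    exact iff_of_false (not_lt.2 (Fin.le_last _)) (not_lt.2 (Fin.le_last _))
  have hV : ∀ y, w⁻¹ y < y ↔ w'⁻¹ y < y := by
    intro y
    refine Fin.cases ?_ (fun i => (hsteps i).2) y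
    exact iff_of_false (not_lt.2 (Fin.zero_le _)) (not_lt.2 (Fin.zero_le _))
  refine perm_eq_of_strictMonoOn (fun x => x < w x) (fun y => w⁻¹ y < y) ?_ ?_ ?_ ?_
  · intro x
    rw [show w⁻¹ (w x) = x from w.symm_apply_apply x]
  · intro x
    rw [hV, show w'⁻¹ (w' x) = x from w'.symm_apply_apply x, hE]
  · exact fun x y hxy h => hw.lt_of_iff hxy h
  · intro x y hxy h
    rw [hE, hE] at h
    exact hw'.lt_of_iff hxy h

/-- The permutation that is increasing from `E` to `V` and from the complement of `E` to the
complement of `V`. -/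
theorem exists_perm_of_card_eq {m : ℕ} (E V : Fin m → Prop) [DecidablePred E] [DecidablePred V]
    (h : Fintype.card {x // E x} = Fintype.card {x // V x}) :
    ∃ w : Equiv.Perm (Fin m), (∀ x, V (w x) ↔ E x) ∧
      ∀ x y, x < y → (E x ↔ E y) → w x < w y := by
  have h' : Fintype.card {x // ¬ E x} = Fintype.card {x // ¬ V x} := by
    rw [Fintype.card_subtype_compl, Fintype.card_subtype_compl, h]
  let e : {x // E x} ≃o {x // V x} :=
    (monoEquivOfFin {x // E x} h).symm.trans (monoEquivOfFin {x // V x} rfl)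
  let f : {x // ¬ E x} ≃o {x // ¬ V x} :=
    (monoEquivOfFin {x // ¬ E x} h').symm.trans (monoEquivOfFin {x // ¬ V x} rfl)
  refine ⟨Equiv.subtypeCongr e.toEquiv f.toEquiv, ?_, ?_⟩
  · intro x
    by_cases hx : E x
    · simp [Equiv.subtypeCongr, hx, Equiv.sumCompl_symm_apply_of_pos, (e ⟨x, hx⟩).2]
    · simp [Equiv.subtypeCongr, hx, Equiv.sumCompl_symm_apply_of_neg, (f ⟨x, hx⟩).2]
  · intro x y hxy hE
    by_cases hx : E x
    · have hy := hE.1 hx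
      have : e ⟨x, hx⟩ < e ⟨y, hy⟩ := e.strictMono hxy
      simpa [Equiv.subtypeCongr, hx, hy, Equiv.sumCompl_symm_apply_of_pos] using this
    · have hy : ¬ E y := fun h => hx (hE.2 h)
      have : f ⟨x, hx⟩ < f ⟨y, hy⟩ := f.strictMono hxy
      simpa [Equiv.subtypeCongr, hx, hy, Equiv.sumCompl_symm_apply_of_neg] using this

open Finset in
theorem card_filter_lt_succ {m : ℕ} (E : Fin m → Prop) [DecidablePred E] (j : ℕ) (hj : j < m) :
    #{x : Fin m | E x ∧ (x : ℕ) < j + 1} =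
      #{x : Fin m | E x ∧ (x : ℕ) < j} + if E ⟨j, hj⟩ then 1 else 0 := by
  have h : ({x : Fin m | E x ∧ (x : ℕ) < j + 1} : Finset (Fin m)) =
      ({x : Fin m | E x ∧ (x : ℕ) < j} : Finset (Fin m)) ∪
        (if E ⟨j, hj⟩ then {⟨j, hj⟩} else ∅) := by
    ext x
    by_cases hxj : (x : ℕ) = j
    · obtain rfl : x = ⟨j, hj⟩ := Fin.ext hxj
      split_ifs with h <;> simp [h]
    · have : ¬ x = ⟨j, hj⟩ := fun h => hxj (congrArg Fin.val h)
      have h' : (x : ℕ) ≤ j ↔ (x : ℕ) < j := by omega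
      split_ifs <;> simp [this, h']
  rw [h, card_union_of_disjoint]
  · split_ifs <;> simp
  · split_ifs <;> simp

open Finset in
/-- A map that is increasing on `E` and maps it to `V` preserves ranks. -/
theorem card_filter_lt_eq {m : ℕ} (w : Equiv.Perm (Fin m)) (E V : Fin m → Prop) [DecidablePred E]
    [DecidablePred V] (hV : ∀ x, V (w x) ↔ E x) (hm : ∀ x y, x < y → (E x ↔ E y) → w x < w y)
    {x : Fin m} (hx : E x) :
    #{y : Fin m | V y ∧ (y : ℕ) < w x} = #{y : Fin m | E y ∧ (y : ℕ) < x} := by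
  refine (card_equiv w fun y => ?_).symm
  simp only [mem_filter, mem_univ, true_and, hV]
  refine and_congr_right fun hy => ?_
  rw [← Fin.lt_def, ← Fin.lt_def]
  refine ⟨fun h => hm _ _ h (iff_of_true hy hx), fun h => ?_⟩
  rcases lt_trichotomy y x with h' | rfl | h'
  · exact h'
  · exact absurd h (lt_irrefl _)
  · exact absurd (hm _ _ h' (iff_of_true hx hy)) (not_lt.2 h.le)

open Finset in
/-- Every pair of paths subject to the ballot condition comes from a permutation avoiding `321`. -/
theorem exists_steps_eq {P : List (Bool × Bool)} (hP : GoodFrom 0 P) :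
    ∃ w : Equiv.Perm (Fin (P.length + 1)), Avoids321 w ∧ steps w = P := by
  classical
  set n := P.length with hn
  let E : Fin (n + 1) → Prop := fun x => ∃ h : (x : ℕ) < n, P[(x : ℕ)].1 = true
  let V : Fin (n + 1) → Prop := fun y => ∃ (j : ℕ) (h : j < n), (y : ℕ) = j + 1 ∧ P[j].2 = true
  obtain ⟨hpos, hend⟩ := (goodFrom_iff _ _).1 hP
  have hcE : ∀ j, j ≤ n → sumFst P j = 2 * #{x : Fin (n + 1) | E x ∧ (x : ℕ) < j} - j := by
    intro j hj
    induction j with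
    | zero => simp
    | succ j ih =>
      rw [sumFst_succ P j (by omega), card_filter_lt_succ E j (by omega), ih (by omega)]
      have : E ⟨j, by omega⟩ ↔ P[j].1 = true := ⟨fun h => h.2, fun h => ⟨hj, h⟩⟩
      rw [if_congr this rfl rfl, sgn]
      split_ifs <;> push_cast <;> ring
  have hcV : ∀ j, j ≤ n → sumSnd P j = 2 * #{x : Fin (n + 1) | V x ∧ (x : ℕ) < j + 1} - j := by
    intro j hj
    induction j with
    | zero =>
      rw [card_filter_lt_succ V 0 (by omega), if_neg]
      · simp
      · rintro ⟨i, -, hi, -⟩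
        simp at hi
    | succ j ih =>
      rw [sumSnd_succ P j (by omega), card_filter_lt_succ V (j + 1) (by omega), ih (by omega)]
      have : V ⟨j + 1, by omega⟩ ↔ P[j].2 = true := by
        constructor
        · rintro ⟨i, h, hi, hi'⟩
          obtain rfl : i = j := by simpa using hi.symm
          exact hi'
        · intro h
          exact ⟨j, hj, rfl, h⟩
      rw [if_congr this rfl rfl, sgn]
      split_ifs <;> push_cast <;> ring
  have hcard : Fintype.card {x // E x} = Fintype.card {x // V x} := by
    have h₁ := hcE n le_rfl
    have h₂ := hcV n le_rfl
    rw [Fintype.card_subtype, Fintype.card_subtype]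
    have e₁ : (univ.filter fun x : Fin (n + 1) => E x ∧ (x : ℕ) < n) = univ.filter E := by
      ext x
      simp only [mem_filter, mem_univ, true_and, and_iff_left_iff_imp]
      exact fun h => h.1
    have e₂ : (univ.filter fun x : Fin (n + 1) => V x ∧ (x : ℕ) < n + 1) = univ.filter V := by
      ext x
      simp only [mem_filter, mem_univ, true_and, and_iff_left_iff_imp]
      exact fun _ => x.2
    rw [e₁] at h₁
    rw [e₂] at h₂
    rw [← hn] at hend
    have : #(univ.filter E) = #(univ.filter V) := by omega
    convert this
  obtain ⟨w, hwV, hwm⟩ := exists_perm_of_card_eq E V hcard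
  have hcompl : ∀ (Q : Fin (n + 1) → Prop) [DecidablePred Q] (j : ℕ), j ≤ n + 1 →
      #{x : Fin (n + 1) | Q x ∧ (x : ℕ) < j} + #{x : Fin (n + 1) | ¬ Q x ∧ (x : ℕ) < j} = j := by
    intro Q _ j hj
    induction j with
    | zero => simp
    | succ j ih =>
      rw [card_filter_lt_succ _ j (by omega), card_filter_lt_succ _ j (by omega)]
      have := ih (by omega)
      split_ifs <;> omega
  -- The ballot condition says that the `r`-th element of `E` is smaller than the `r`-th element
  -- of `V`, and that the reverse holds weakly for the complements.
  have hexc : ∀ x, E x ↔ x < w x := by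
    intro x
    have hxn : (x : ℕ) ≤ n := by omega
    have h₁ := hpos x hxn
    rw [hcE x hxn, hcV x hxn] at h₁
    constructor
    · intro hx
      by_contra hlt
      have hle : (w x : ℕ) < x + 1 := by
        rw [not_lt, Fin.le_def] at hlt
        omega
      have h₂ := card_filter_lt_eq w E V hwV hwm hx
      have h₃ := card_filter_lt_succ V (w x) (w x).2
      rw [if_pos ((hwV x).2 hx)] at h₃
      have h₄ : #{y : Fin (n + 1) | V y ∧ (y : ℕ) < w x + 1} ≤
          #{y : Fin (n + 1) | V y ∧ (y : ℕ) < x + 1} := by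
        refine card_le_card fun y hy => ?_
        simp only [mem_filter, mem_univ, true_and] at hy ⊢
        exact ⟨hy.1, by omega⟩
      omega
    · intro hlt
      by_contra hx
      have h₂ := card_filter_lt_eq w (fun x => ¬ E x) (fun x => ¬ V x)
        (fun x => not_congr (hwV x)) (fun x y hxy h => hwm x y hxy (not_iff_not.1 h)) hx
      have h₃ : #{y : Fin (n + 1) | ¬ V y ∧ (y : ℕ) < x + 1} ≤
          #{y : Fin (n + 1) | ¬ V y ∧ (y : ℕ) < w x} := by
        refine card_le_card fun y hy => ?_
        simp only [mem_filter, mem_univ, true_and] at hy ⊢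
        rw [Fin.lt_def] at hlt
        exact ⟨hy.1, by omega⟩
      have h₄ := hcompl E x (by omega)
      have h₅ := hcompl V (x + 1) (by omega)
      omega
  refine ⟨w, ?_, ?_⟩
  · rintro ⟨f, hf, h⟩
    have hno : ∀ a b : Fin 3, a < b → ¬ (E (f a) ↔ E (f b)) := by
      intro a b hab hE
      have h₁ := (h a b hab).1 (hwm _ _ (hf hab) hE)
      exact lt_asymm hab (by simpa using h₁)
    have h₁ := hno 0 1 (by decide)
    have h₂ := hno 1 2 (by decide)
    have h₃ := hno 0 2 (by decide)
    tauto
  · refine List.ext_getElem (by simp [hn]) fun j h₁ h₂ => ?_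
    have hj : j < n := by simpa using h₁
    have e₁ := hexc (⟨j, hj⟩ : Fin n).castSucc
    have e₂ : V (⟨j, hj⟩ : Fin n).succ ↔ w⁻¹ (⟨j, hj⟩ : Fin n).succ < (⟨j, hj⟩ : Fin n).succ := by
      have h₃ := hwV (w⁻¹ (⟨j, hj⟩ : Fin n).succ)
      have h₄ := hexc (w⁻¹ (⟨j, hj⟩ : Fin n).succ)
      rw [apply_inv] at h₃ h₄
      rw [h₃, h₄]
    have f₁ : E (⟨j, hj⟩ : Fin n).castSucc ↔ P[j].1 = true := ⟨fun h => h.2, fun h => ⟨hj, h⟩⟩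
    have f₂ : V (⟨j, hj⟩ : Fin n).succ ↔ P[j].2 = true := by
      constructor
      · rintro ⟨i, h, hi, hi'⟩
        obtain rfl : i = j := by simpa using hi.symm
        exact hi'
      · intro h
        exact ⟨j, hj, rfl, h⟩
    simp only [steps, List.getElem_ofFn]
    refine Prod.ext ?_ ?_
    · rw [Bool.eq_iff_iff, decide_eq_true_iff, ← e₁, f₁]
    · rw [Bool.eq_iff_iff, decide_eq_true_iff, ← e₂, f₂]

/-! ### Decompositions of lattice paths -/

/-- No column is empty, for the paths encoded by the list started with height difference `t`. -/
def NoEmptyColumn : ℤ → List (Bool × Bool) → Prop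
  | _, [] => True
  | t, a :: P => 1 ≤ t + sgn a.1 ∧ NoEmptyColumn (t + sgn a.1 - sgn a.2) P

theorem noEmptyColumn_iff (t : ℤ) (P : List (Bool × Bool)) :
    NoEmptyColumn t P ↔ ∀ j, j < P.length → lower P j ≤ upper P j + t := by
  induction P generalizing t with
  | nil => simp [NoEmptyColumn]
  | cons a P ih =>
    rw [NoEmptyColumn, ih]
    simp only [lower, upper]
    constructor
    · rintro ⟨h₁, h₂⟩ j hj
      cases j with
      | zero => rw [sumSnd_zero, sumFst_cons, sumFst_zero]; omega
      | succ j =>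
        have := h₂ j (by simpa using hj)
        rw [sumSnd_cons, sumFst_cons]
        omega
    · intro h
      constructor
      · have := h 0 (by simp)
        rw [sumSnd_zero, sumFst_cons, sumFst_zero] at this
        omega
      · intro j hj
        have := h (j + 1) (by simpa using hj)
        rw [sumSnd_cons, sumFst_cons] at this
        omega

theorem GoodFrom.nonneg {t : ℤ} {P : List (Bool × Bool)} (h : GoodFrom t P) : 0 ≤ t := by
  cases P with
  | nil => exact le_of_eq (Eq.symm h)
  | cons a P => exact h.1

theorem GoodFrom.append_iff {a t : ℤ} {Q R : List (Bool × Bool)} (hQ : GoodFrom a Q)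
    (ht : 0 ≤ t) : GoodFrom (a + t) (Q ++ R) ↔ GoodFrom t R := by
  induction Q generalizing a with
  | nil =>
    obtain rfl : a = 0 := hQ
    simp
  | cons x Q ih =>
    rw [List.cons_append, GoodFrom, ← ih hQ.2]
    have := hQ.1
    rw [show a + sgn x.1 - sgn x.2 + t = a + t + sgn x.1 - sgn x.2 by ring]
    exact and_iff_right (by omega)

/-- The first descent of the height difference from `2` to `0`. -/
theorem GoodFrom.exists_first_return {t : ℤ} {R : List (Bool × Bool)} (hR : GoodFrom t R)
    (ht : 2 ≤ t) (hpar : t % 2 = 0) :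
    ∃ Q P, R = Q ++ (false, true) :: P ∧ GoodFrom (t - 2) Q ∧ GoodFrom 0 P := by
  induction R generalizing t with
  | nil =>
    have : t = 0 := hR
    omega
  | cons a R ih =>
    obtain ⟨-, hR⟩ := hR
    have h0 := hR.nonneg
    have h₁ := sgn_eq a.1
    have h₂ := sgn_eq a.2
    by_cases h : 2 ≤ t + sgn a.1 - sgn a.2
    · obtain ⟨Q, P, rfl, hQ, hP⟩ := ih hR h (by omega)
      refine ⟨a :: Q, P, rfl, ⟨by omega, ?_⟩, hP⟩
      rwa [show t - 2 + sgn a.1 - sgn a.2 = t + sgn a.1 - sgn a.2 - 2 by ring]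
    · obtain ⟨a₁, a₂⟩ := a
      simp only at *
      have e₁ : a₁ = false := by
        cases a₁
        · rfl
        · simp [sgn] at h₁ h h0; split_ifs at h h0 <;> omega
      have e₂ : a₂ = true := by
        cases a₂
        · simp [sgn] at h₂ h h0; split_ifs at h h0 <;> omega
        · rfl
      subst e₁ e₂
      simp only [sgn, if_true, Bool.false_eq_true, if_false] at hR h h0
      obtain rfl : t = 2 := by omega
      exact ⟨[], R, rfl, rfl, by simpa using hR⟩

theorem GoodFrom.first_return_unique {a : ℤ} {Q Q' P P' : List (Bool × Bool)} (hQ : GoodFrom a Q)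
    (hQ' : GoodFrom a Q') (h : Q ++ (false, true) :: P = Q' ++ (false, true) :: P') :
    Q = Q' ∧ P = P' := by
  induction Q generalizing a Q' with
  | nil =>
    obtain rfl : a = 0 := hQ
    cases Q' with
    | nil => exact ⟨rfl, (List.cons.inj h).2⟩
    | cons x Q' =>
      obtain ⟨rfl, -⟩ := List.cons.inj h
      have := hQ'.2.nonneg
      simp [sgn] at this
  | cons x Q ih =>
    cases Q' with
    | nil =>
      obtain rfl : a = 0 := hQ'
      obtain ⟨rfl, -⟩ := List.cons.inj h
      have := hQ.2.nonneg
      simp [sgn] at this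
    | cons x' Q' =>
      obtain ⟨rfl, h'⟩ := List.cons.inj h
      obtain ⟨rfl, rfl⟩ := ih hQ.2 hQ'.2 h'
      exact ⟨rfl, rfl⟩

/-- The first empty column of a pair of lattice paths. -/
theorem GoodFrom.exists_empty_column {t : ℤ} {R : List (Bool × Bool)} (hR : GoodFrom t R)
    (hpar : t % 2 = 0) : NoEmptyColumn t R ∨ ∃ Q P, R = Q ++ (false, false) :: P ∧
      GoodFrom t Q ∧ NoEmptyColumn t Q ∧ GoodFrom 0 P := by
  induction R generalizing t with
  | nil => exact Or.inl trivial
  | cons a R ih =>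
    obtain ⟨ht, hR⟩ := hR
    have h0 := hR.nonneg
    have h₁ := sgn_eq a.1
    have h₂ := sgn_eq a.2
    by_cases h : 1 ≤ t + sgn a.1
    · rcases ih hR (by omega) with hn | ⟨Q, P, rfl, hQ, hQ', hP⟩
      · exact Or.inl ⟨h, hn⟩
      · exact Or.inr ⟨a :: Q, P, rfl, ⟨ht, hQ⟩, ⟨h, hQ'⟩, hP⟩
    · obtain ⟨a₁, a₂⟩ := a
      simp only at *
      have e₁ : a₁ = false := by
        cases a₁
        · rfl
        · simp [sgn] at h; omega
      subst e₁
      have e₂ : a₂ = false := by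
        cases a₂
        · rfl
        · simp [sgn] at h h0; omega
      subst e₂
      simp only [sgn, Bool.false_eq_true, if_false] at hR h h0
      obtain rfl : t = 0 := by omega
      exact Or.inr ⟨[], R, rfl, rfl, trivial, by simpa using hR⟩

theorem GoodFrom.not_noEmptyColumn_append {t : ℤ} {Q P : List (Bool × Bool)} (hQ : GoodFrom t Q) :
    ¬ NoEmptyColumn t (Q ++ (false, false) :: P) := by
  induction Q generalizing t with
  | nil =>
    obtain rfl : t = 0 := hQ
    rintro ⟨h, -⟩
    simp [sgn] at h
  | cons x Q ih => exact fun h => ih hQ.2 h.2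

theorem GoodFrom.empty_column_unique {a : ℤ} {Q Q' P P' : List (Bool × Bool)} (hQ : GoodFrom a Q)
    (hQ' : GoodFrom a Q') (hn : NoEmptyColumn a Q) (hn' : NoEmptyColumn a Q')
    (h : Q ++ (false, false) :: P = Q' ++ (false, false) :: P') : Q = Q' ∧ P = P' := by
  induction Q generalizing a Q' with
  | nil =>
    obtain rfl : a = 0 := hQ
    cases Q' with
    | nil => exact ⟨rfl, (List.cons.inj h).2⟩
    | cons x Q' =>
      obtain ⟨rfl, -⟩ := List.cons.inj h
      have := hn'.1
      simp [sgn] at this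
  | cons x Q ih =>
    cases Q' with
    | nil =>
      obtain rfl : a = 0 := hQ'
      obtain ⟨rfl, -⟩ := List.cons.inj h
      have := hn.1
      simp [sgn] at this
    | cons x' Q' =>
      obtain ⟨rfl, h'⟩ := List.cons.inj h
      obtain ⟨rfl, rfl⟩ := ih hQ.2 hQ'.2 hn.2 hn'.2 h'
      exact ⟨rfl, rfl⟩

/-! ### Containment of a region and separating columns -/

/-- A translate of the region between `A` and `B` in columns `0, …, k - 1` is contained in the
region of the pair of paths encoded by `P`, started with height difference `t`. -/
def Fits (A B : ℕ → ℤ) (k : ℕ) (t : ℤ) (P : List (Bool × Bool)) : Prop :=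
  ∃ (c : ℕ) (d : ℤ), c + k ≤ P.length ∧
    ∀ j, j < k → lower P (c + j) ≤ A j + d ∧ B j + d ≤ upper P (c + j) + t

theorem sumFst_append_left (X Y : List (Bool × Bool)) {j : ℕ} (hj : j ≤ X.length) :
    sumFst (X ++ Y) j = sumFst X j := by
  rw [sumFst, sumFst, List.take_append_of_le_length hj]

theorem sumSnd_append_left (X Y : List (Bool × Bool)) {j : ℕ} (hj : j ≤ X.length) :
    sumSnd (X ++ Y) j = sumSnd X j := by
  rw [sumSnd, sumSnd, List.take_append_of_le_length hj]

theorem sumFst_append_right (X Y : List (Bool × Bool)) (j : ℕ) :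
    sumFst (X ++ Y) (X.length + j) = sumFst X X.length + sumFst Y j := by
  simp only [sumFst, List.take_append, Nat.add_sub_cancel_left, List.map_append, List.sum_append,
    List.take_of_length_le (Nat.le_add_right _ _), List.take_length]

theorem sumSnd_append_right (X Y : List (Bool × Bool)) (j : ℕ) :
    sumSnd (X ++ Y) (X.length + j) = sumSnd X X.length + sumSnd Y j := by
  simp only [sumSnd, List.take_append, Nat.add_sub_cancel_left, List.map_append, List.sum_append,
    List.take_of_length_le (Nat.le_add_right _ _), List.take_length]

/-- A column without points of the region separates the two sides. -/
theorem fits_append_cons {A B : ℕ → ℤ} {k : ℕ} (hAB : ∀ j, j < k → A j ≤ B j) (t : ℤ)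
    (X Y : List (Bool × Bool)) (a : Bool × Bool)
    (ha : sumFst X X.length + sgn a.1 - 1 + t < sumSnd X X.length) :
    Fits A B k t (X ++ a :: Y) ↔ Fits A B k t X ∨
      Fits A B k (t + sumFst X X.length - sumSnd X X.length + sgn a.1 - sgn a.2) Y := by
  constructor
  · rintro ⟨c, d, hc, h⟩
    rw [List.length_append, List.length_cons] at hc
    by_cases h₁ : c + k ≤ X.length
    · refine Or.inl ⟨c, d, h₁, fun j hj => ?_⟩
      have := h j hj
      rwa [lower, upper, sumFst_append_left _ _ (by omega), sumSnd_append_left _ _ (by omega)]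
        at this
    by_cases h₂ : X.length < c
    · obtain ⟨c, rfl⟩ := Nat.exists_eq_add_of_lt h₂
      refine Or.inr ⟨c, d - sumSnd X X.length - sgn a.2, by omega, fun j hj => ?_⟩
      have := h j hj
      rw [lower, upper, show X.length + c + 1 + j = X.length + (c + j + 1) by omega,
        show X.length + (c + j + 1) + 1 = X.length + (c + j + 1 + 1) by omega,
        sumFst_append_right, sumSnd_append_right, sumFst_cons, sumSnd_cons] at this
      rw [lower, upper]
      omega
    · exfalso
      have h₃ := h (X.length - c) (by omega)
      have h₄ := hAB (X.length - c) (by omega)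
      rw [Nat.add_sub_cancel' (not_lt.1 h₂), lower, upper, sumFst_append_right,
        sumSnd_append_left _ _ le_rfl, sumFst_cons, sumFst_zero] at h₃
      omega
  · rintro (⟨c, d, hc, h⟩ | ⟨c, d, hc, h⟩)
    · refine ⟨c, d, by simp; omega, fun j hj => ?_⟩
      have := h j hj
      rwa [lower, upper, sumFst_append_left _ _ (by omega), sumSnd_append_left _ _ (by omega)]
    · refine ⟨X.length + c + 1, d + sumSnd X X.length + sgn a.2, by simp; omega, fun j hj => ?_⟩
      have := h j hj
      rw [lower, upper] at this
      rw [lower, upper, show X.length + c + 1 + j = X.length + (c + j + 1) by omega,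
        show X.length + (c + j + 1) + 1 = X.length + (c + j + 1 + 1) by omega,
        sumFst_append_right, sumSnd_append_right, sumFst_cons, sumSnd_cons]
      omega

theorem GoodFrom.sum_eq {t : ℤ} {P : List (Bool × Bool)} (h : GoodFrom t P) :
    t + sumFst P P.length - sumSnd P P.length = 0 :=
  ((goodFrom_iff _ _).1 h).2

theorem not_fits_nil {A B : ℕ → ℤ} {k : ℕ} (hk : 0 < k) (t : ℤ) : ¬ Fits A B k t [] := by
  rintro ⟨c, d, hc, -⟩
  rw [List.length_nil] at hc
  omega

theorem fits_cons {A B : ℕ → ℤ} {k : ℕ} (hk : 0 < k) (hAB : ∀ j, j < k → A j ≤ B j)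
    (t : ℤ) (P : List (Bool × Bool)) (a : Bool × Bool)
    (ha : sgn a.1 - 1 + t < 0) :
    Fits A B k t (a :: P) ↔ Fits A B k (t + sgn a.1 - sgn a.2) P := by
  have := fits_append_cons hAB t [] P a (by simpa using ha)
  simpa [not_fits_nil hk] using this

theorem fits_excursion {A B : ℕ → ℤ} {k : ℕ} (hk : 0 < k) (hAB : ∀ j, j < k → A j ≤ B j)
    {Q : List (Bool × Bool)} (hQ : GoodFrom 0 Q) (P : List (Bool × Bool)) :
    Fits A B k (-2) ((true, false) :: (Q ++ (false, true) :: P)) ↔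
      Fits A B k 0 Q ∨ Fits A B k (-2) P := by
  have hs := hQ.sum_eq
  rw [fits_cons hk hAB _ _ _ (by simp [sgn]), fits_append_cons hAB]
  · have e : (-2 + sgn (true, false).1 - sgn (true, false).2 : ℤ) = 0 := by simp [sgn]
    have e' : 0 + sumFst Q Q.length - sumSnd Q Q.length + sgn (false, true).1 -
        sgn (false, true).2 = -2 := by
      rw [hs]; simp [sgn]
    rw [e, e']
  · simp [sgn]
    omega

/-! ### Heap containment under diamond reduction -/

theorem heapContains_iff_fits {n k : ℕ} {w : Equiv.Perm (Fin (n + 1))}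
    {g : Equiv.Perm (Fin (k + 1))} (hw : Avoids321 w) (hg : Avoids321 g) (hk : 0 < k)
    (hne : ∀ j, j < k → lower (steps g) j ≤ upper (steps g) j) :
    HeapContains w g ↔ Fits (lower (steps g)) (upper (steps g)) k 0 (steps w) := by
  rw [heapContains_iff hw hg hk hne, Fits]
  simp only [length_steps, add_zero]

/-- Removing the boundary paths of the regions of both `w` and `h` does not affect containment:
the columns of the smaller region are never outermost for `w`, and the outermost columns of `h`,
which have a single entry, take care of themselves. -/
theorem heapContains_iff_fits_of_isDiamondReduction {n k : ℕ} (hk : 1 ≤ k)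
    {w : Equiv.Perm (Fin (n + 1))} {h : Equiv.Perm (Fin (k + 2 + 1))} {g : Equiv.Perm (Fin (k + 1))}
    (hw : Avoids321 w) (hconn : Connected h) (hfc : FullyCommutative h)
    (htwo : TwoInInternalColumns h) (hg : IsDiamondReduction h g) :
    HeapContains w h ↔ Fits (lower (steps g)) (upper (steps g)) k (-2) (steps w) := by
  have hh := hfc.avoids321
  obtain ⟨-, hne, e, he⟩ := exists_shift_of_isDiamondReduction hk hh htwo hg
  rw [heapContains_iff hw hh (by omega) ((connected_iff hh).1 hconn).2, Fits, length_steps]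
  constructor
  · rintro ⟨c, d, hc, hd⟩
    refine ⟨c + 1, d - 1 - e, by omega, fun j hj => ?_⟩
    have h₁ := hd (j + 1) (by omega)
    have h₂ := he j hj
    rw [show c + (j + 1) = c + 1 + j by omega] at h₁
    omega
  · rintro ⟨c, d, hc, hd⟩
    obtain ⟨u, hu⟩ := exists_isReducedWord w
    obtain ⟨y, hy⟩ := hw.exists_isHeapShape hu
    obtain ⟨v, hv⟩ := exists_isReducedWord h
    obtain ⟨y', hy'⟩ := hh.exists_isHeapShape hv
    have hc0 : c ≠ 0 := by
      rintro rfl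
      have h₁ := hd 0 hk
      have h₂ := hne 0 hk
      have h₃ := hy.first (by omega)
      rw [add_zero] at h₁
      omega
    obtain ⟨c, rfl⟩ := Nat.exists_eq_succ_of_ne_zero hc0
    rw [Nat.succ_eq_add_one] at hc hd
    obtain ⟨m, rfl⟩ : ∃ m, k = m + 1 := ⟨k - 1, by omega⟩
    have hcn : c + 1 + m + 1 ≠ n := by
      intro hcn
      have h₁ := hd m (by omega)
      have h₂ := hne m (by omega)
      have h₃ := hy.last (c + 1 + m) (Nat.zero_le _) (by omega)
      omega
    refine ⟨c, d + 1 + e, by omega, fun j hj => ?_⟩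
    rcases Nat.eq_zero_or_pos j with rfl | hj0
    · have a₁ := hd 0 (by omega)
      have a₂ := he 0 (by omega)
      have a₃ := hne 0 (by omega)
      have a₄ := hy'.first (by omega)
      have a₅ := hy'.lo_step 0 le_rfl (by omega)
      have a₆ := hy'.hi_step 0 le_rfl (by omega)
      have a₇ := hy.lo_step c (Nat.zero_le _) (by omega)
      have a₈ := hy.hi_step c (Nat.zero_le _) (by omega)
      simp only [add_zero, zero_add] at *
      omega
    rcases Nat.lt_or_ge j (m + 2) with hj' | hj'
    · obtain ⟨j, rfl⟩ : ∃ i, j = i + 1 := ⟨j - 1, by omega⟩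
      have a₁ := hd j (by omega)
      have a₂ := he j (by omega)
      rw [show c + (j + 1) = c + 1 + j by omega]
      omega
    · obtain rfl : j = m + 2 := by omega
      have a₁ := hd m (by omega)
      have a₂ := he m (by omega)
      have a₃ := hne m (by omega)
      have a₄ := hy'.last (m + 1 + 1) (Nat.zero_le _) (by omega)
      have a₅ := hy'.lo_step (m + 1) (Nat.zero_le _) (by omega)
      have a₆ := hy'.hi_step (m + 1) (Nat.zero_le _) (by omega)
      have a₇ := hy.lo_step (c + 1 + m) (Nat.zero_le _) (by omega)
      have a₈ := hy.hi_step (c + 1 + m) (Nat.zero_le _) (by omega)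
      rw [show c + (m + 2) = c + 1 + m + 1 by omega, show m + 2 = m + 1 + 1 by omega]
      omega

/-! ### Generating functions of sets of lists -/

/-- The generating function of a set of step lists by length. -/
noncomputable def listGenFun (S : Set (List (Bool × Bool))) : PowerSeries ℚ :=
  PowerSeries.mk fun n => ((S ∩ {P | P.length = n}).ncard : ℚ)

theorem finite_inter_length (S : Set (List (Bool × Bool))) (n : ℕ) :
    (S ∩ {P | P.length = n}).Finite :=
  (List.finite_length_eq _ n).subset Set.inter_subset_right

theorem listGenFun_union {S S' : Set (List (Bool × Bool))} (h : Disjoint S S') :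
    listGenFun (S ∪ S') = listGenFun S + listGenFun S' := by
  ext n
  simp only [listGenFun, map_add, PowerSeries.coeff_mk]
  rw [Set.union_inter_distrib_right, Set.ncard_union_eq
    (h.mono Set.inter_subset_left Set.inter_subset_left) (finite_inter_length _ _)
    (finite_inter_length _ _)]
  push_cast
  rfl

theorem listGenFun_nil : listGenFun {[]} = 1 := by
  ext n
  rw [listGenFun, PowerSeries.coeff_mk, PowerSeries.coeff_one]
  split_ifs with hn
  · rw [show ({[]} : Set (List (Bool × Bool))) ∩ {P | P.length = n} = {[]} by
      ext P; subst hn; simp, Set.ncard_singleton]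
    simp
  · rw [show ({[]} : Set (List (Bool × Bool))) ∩ {P | P.length = n} = ∅ by
      ext P
      simp only [Set.mem_inter_iff, Set.mem_singleton_iff, Set.mem_ofPred_eq,
        Set.mem_empty_iff_false, iff_false, not_and]
      rintro rfl
      simpa using Ne.symm hn, Set.ncard_empty]
    simp

open Finset in
theorem listGenFun_image2 {S S' : Set (List (Bool × Bool))} (c : ℕ)
    (f : List (Bool × Bool) → List (Bool × Bool) → List (Bool × Bool))
    (hlen : ∀ P ∈ S, ∀ Q ∈ S', (f P Q).length = P.length + Q.length + c)
    (hinj : ∀ P ∈ S, ∀ Q ∈ S', ∀ P' ∈ S, ∀ Q' ∈ S', f P Q = f P' Q' → P = P' ∧ Q = Q') :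
    listGenFun (Set.image2 f S S') = PowerSeries.X ^ c * (listGenFun S * listGenFun S') := by
  classical
  ext n
  rw [PowerSeries.coeff_X_pow_mul', listGenFun, PowerSeries.coeff_mk]
  split_ifs with hc
  · let A : ℕ → Finset (List (Bool × Bool)) := fun i => (finite_inter_length S i).toFinset
    let B : ℕ → Finset (List (Bool × Bool)) := fun i => (finite_inter_length S' i).toFinset
    have hA : ∀ i P, P ∈ A i ↔ P ∈ S ∧ P.length = i := fun i P => by simp [A]
    have hB : ∀ i P, P ∈ B i ↔ P ∈ S' ∧ P.length = i := fun i P => by simp [B]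
    have hAc : ∀ i, (S ∩ {P | P.length = i}).ncard = #(A i) := fun i => by
      rw [← Set.ncard_coe_finset]; simp [A]
    have hBc : ∀ i, (S' ∩ {P | P.length = i}).ncard = #(B i) := fun i => by
      rw [← Set.ncard_coe_finset]; simp [B]
    have hset : Set.image2 f S S' ∩ {P | P.length = n} =
        ↑((antidiagonal (n - c)).biUnion fun p =>
          (A p.1 ×ˢ B p.2).image (Function.uncurry f)) := by
      ext R
      simp only [Set.mem_inter_iff, Set.mem_image2, Set.mem_ofPred_eq, coe_biUnion, coe_image,
        Set.mem_iUnion, Set.mem_image, mem_coe, mem_product, hA, hB, HasAntidiagonal.mem_antidiagonal,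
        Prod.exists, Function.uncurry_apply_pair]
      constructor
      · rintro ⟨⟨P, hP, Q, hQ, rfl⟩, hn⟩
        rw [hlen P hP Q hQ] at hn
        exact ⟨P.length, Q.length, by omega, P, Q, ⟨⟨hP, rfl⟩, hQ, rfl⟩, rfl⟩
      · rintro ⟨i, j, hij, P, Q, ⟨⟨hP, rfl⟩, hQ, rfl⟩, rfl⟩
        exact ⟨⟨P, hP, Q, hQ, rfl⟩, by rw [hlen P hP Q hQ]; omega⟩
    rw [hset, Set.ncard_coe_finset, card_biUnion, PowerSeries.coeff_mul]
    · push_cast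
      refine sum_congr rfl fun p _ => ?_
      rw [card_image_of_injOn, card_product]
      · simp only [listGenFun, PowerSeries.coeff_mk, hAc, hBc]
        push_cast
        rfl
      · rintro ⟨P, Q⟩ hPQ ⟨P', Q'⟩ hPQ' heq
        simp only [coe_product, Set.mem_prod, mem_coe, hA, hB] at hPQ hPQ'
        obtain ⟨rfl, rfl⟩ := hinj P hPQ.1.1 Q hPQ.2.1 P' hPQ'.1.1 Q' hPQ'.2.1 heq
        rfl
    · rintro p _ p' _ hpp'
      refine disjoint_left.2 ?_
      intro R hR hR'
      simp only [mem_image, mem_product, hA, hB, Prod.exists, Function.uncurry_apply_pair]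
        at hR hR'
      obtain ⟨P, Q, ⟨⟨hP, h₁⟩, hQ, h₂⟩, rfl⟩ := hR
      obtain ⟨P', Q', ⟨⟨hP', h₁'⟩, hQ', h₂'⟩, heq⟩ := hR'
      obtain ⟨rfl, rfl⟩ := hinj P' hP' Q' hQ' P hP Q hQ heq
      exact hpp' (Prod.ext (h₁.symm.trans h₁') (h₂.symm.trans h₂'))
  · rw [Set.ncard_eq_zero (finite_inter_length _ _) |>.2]
    · simp
    · rw [Set.eq_empty_iff_forall_notMem]
      rintro R ⟨⟨P, hP, Q, hQ, rfl⟩, hn⟩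
      have := hlen P hP Q hQ
      simp only [Set.mem_ofPred_eq] at hn
      omega

theorem listGenFun_cons (a : Bool × Bool) (S : Set (List (Bool × Bool))) :
    listGenFun ((a :: ·) '' S) = PowerSeries.X * listGenFun S := by
  have h := listGenFun_image2 (S := {[]}) (S' := S) 1 (fun _ P => a :: P)
    (fun P hP Q _ => by rw [Set.mem_singleton_iff.1 hP]; simp)
    (fun P hP Q _ P' hP' Q' _ h => ⟨by rw [Set.mem_singleton_iff.1 hP, Set.mem_singleton_iff.1 hP'],
      (List.cons.inj h).2⟩)
  rw [listGenFun_nil, one_mul, pow_one, Set.image2_singleton_left] at h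
  exact h

/-- Counting permutations by their pairs of lattice paths. -/
theorem card_avoids321_eq {n : ℕ} (p : Equiv.Perm (Fin (n + 1)) → Prop)
    (q : List (Bool × Bool) → Prop) (h : ∀ w, Avoids321 w → (p w ↔ q (steps w))) :
    Nat.card {w : Equiv.Perm (Fin (n + 1)) // Avoids321 w ∧ p w} =
      ({P | GoodFrom 0 P ∧ q P} ∩ {P | P.length = n}).ncard := by
  have himage : {P | GoodFrom 0 P ∧ q P} ∩ {P | P.length = n} =
      steps '' {w : Equiv.Perm (Fin (n + 1)) | Avoids321 w ∧ p w} := by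
    ext P
    constructor
    · rintro ⟨⟨h₁, h₂⟩, rfl⟩
      obtain ⟨w, hw, hwP⟩ := exists_steps_eq h₁
      exact ⟨w, ⟨hw, (h w hw).2 (hwP.symm ▸ h₂)⟩, hwP⟩
    · rintro ⟨w, ⟨hw, hp⟩, rfl⟩
      exact ⟨⟨hw.goodFrom_steps, (h w hw).1 hp⟩, length_steps w⟩
  rw [himage, Set.InjOn.ncard_image fun w hw w' hw' hww' => steps_injOn hw.1 hw'.1 hww',
    ← Nat.card_coe_set_eq]
  rfl

/-! ### The two functional equations -/

/-- The pairs of paths whose region, with the upper path raised by `t`, contains no translate of the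
region between `A` and `B`. -/
def avoidingPaths (A B : ℕ → ℤ) (k : ℕ) (t : ℤ) : Set (List (Bool × Bool)) :=
  {P | GoodFrom 0 P ∧ ¬ Fits A B k t P}

/-- A pair of paths is empty, or starts with one of the two level steps at height difference `0`,
or starts with an excursion to positive height differences.  Inside of the excursion the height
difference is reduced by `2`, which turns containment of `h` into containment of its diamond
reduction. -/
theorem listGenFun_avoidingPaths_neg_two {A B : ℕ → ℤ} {k : ℕ} (hk : 0 < k)
    (hAB : ∀ j, j < k → A j ≤ B j) :
    listGenFun (avoidingPaths A B k (-2)) = 1 +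
      2 * PowerSeries.X * listGenFun (avoidingPaths A B k (-2)) + PowerSeries.X ^ 2 *
        (listGenFun (avoidingPaths A B k 0) * listGenFun (avoidingPaths A B k (-2))) := by
  have hset : avoidingPaths A B k (-2) = {[]} ∪
      (((false, false) :: ·) '' avoidingPaths A B k (-2) ∪
      (((true, true) :: ·) '' avoidingPaths A B k (-2) ∪
      Set.image2 (fun Q P => (true, false) :: (Q ++ (false, true) :: P))
        (avoidingPaths A B k 0) (avoidingPaths A B k (-2)))) := by
    ext R
    simp only [avoidingPaths, Set.mem_union, Set.mem_image, Set.mem_image2, Set.mem_ofPred_eq,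
      Set.mem_singleton_iff]
    constructor
    · rintro ⟨hR, hfit⟩
      rcases R with _ | ⟨⟨_ | _, _ | _⟩, R⟩
      · exact Or.inl rfl
      · rw [fits_cons hk hAB _ _ _ (by simp [sgn])] at hfit
        have := hR.2
        simp only [add_sub_cancel_right] at this hfit
        exact Or.inr (Or.inl ⟨R, ⟨by simpa using this, hfit⟩, rfl⟩)
      · exact absurd hR.2.nonneg (by simp [sgn])
      · have hR' : GoodFrom 2 R := by
          have := hR.2
          simpa [sgn] using this
        obtain ⟨Q, P, rfl, hQ, hP⟩ := hR'.exists_first_return le_rfl rfl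
        rw [sub_self] at hQ
        rw [fits_excursion hk hAB hQ, not_or] at hfit
        exact Or.inr (Or.inr (Or.inr ⟨Q, ⟨hQ, hfit.1⟩, P, ⟨hP, hfit.2⟩, rfl⟩))
      · rw [fits_cons hk hAB _ _ _ (by simp [sgn])] at hfit
        have := hR.2
        simp only [add_sub_cancel_right] at this hfit
        exact Or.inr (Or.inr (Or.inl ⟨R, ⟨by simpa using this, hfit⟩, rfl⟩))
    · rintro (rfl | ⟨P, ⟨hP, hfit⟩, rfl⟩ | ⟨P, ⟨hP, hfit⟩, rfl⟩ |
        ⟨Q, ⟨hQ, hfit'⟩, P, ⟨hP, hfit⟩, rfl⟩)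
      · exact ⟨rfl, not_fits_nil hk _⟩
      · rw [fits_cons hk hAB _ _ _ (by simp [sgn])]
        simpa [GoodFrom, hP] using hfit
      · rw [fits_cons hk hAB _ _ _ (by simp [sgn])]
        simpa [GoodFrom, hP] using hfit
      · rw [fits_excursion hk hAB hQ, not_or]
        refine ⟨⟨le_rfl, ?_⟩, hfit', hfit⟩
        have h₁ : GoodFrom 2 ((false, true) :: P) := ⟨by norm_num, by simpa [sgn] using hP⟩
        have h₂ := (hQ.append_iff (R := (false, true) :: P) (t := 2) (by norm_num)).2 h₁
        simpa [sgn] using h₂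
  conv_lhs => rw [hset]
  rw [listGenFun_union, listGenFun_union, listGenFun_union, listGenFun_nil, listGenFun_cons,
    listGenFun_cons, listGenFun_image2 2]
  · ring
  · intro P _ Q _
    simp
    omega
  · intro Q hQ P _ Q' hQ' P' _ h
    exact GoodFrom.first_return_unique hQ.1 hQ'.1 (List.cons.inj h).2
  · rw [Set.disjoint_left]
    rintro _ ⟨P, -, rfl⟩ ⟨Q, -, P', -, h⟩
    simp at h
  · rw [Set.disjoint_left]
    rintro _ ⟨P, -, rfl⟩ (⟨P', -, h⟩ | ⟨Q, -, P', -, h⟩) <;> simp at h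
  · rw [Set.disjoint_left]
    rintro _ rfl (⟨P', -, h⟩ | ⟨P', -, h⟩ | ⟨Q, -, P', -, h⟩) <;> simp at h

/-- Splitting a heap at its first empty column. -/
theorem listGenFun_avoidingPaths_zero {A B : ℕ → ℤ} {k : ℕ} (hk : 0 < k)
    (hAB : ∀ j, j < k → A j ≤ B j) :
    listGenFun (avoidingPaths A B k 0) =
      (1 + listGenFun {P | GoodFrom 0 P ∧ ¬ Fits A B k 0 P ∧ P ≠ [] ∧ NoEmptyColumn 0 P}) *
        (1 + PowerSeries.X * listGenFun (avoidingPaths A B k 0)) := by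
  have hsep : ∀ Q P, GoodFrom 0 Q → (Fits A B k 0 (Q ++ (false, false) :: P) ↔
      Fits A B k 0 Q ∨ Fits A B k 0 P) := by
    intro Q P hQ
    have hs := hQ.sum_eq
    rw [fits_append_cons hAB, hs]
    · simp
    · simp [sgn]
      omega
  have hset : avoidingPaths A B k 0 =
      {P | GoodFrom 0 P ∧ ¬ Fits A B k 0 P ∧ NoEmptyColumn 0 P} ∪
      Set.image2 (fun Q P => Q ++ (false, false) :: P)
        {P | GoodFrom 0 P ∧ ¬ Fits A B k 0 P ∧ NoEmptyColumn 0 P} (avoidingPaths A B k 0) := by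
    ext R
    simp only [avoidingPaths, Set.mem_union, Set.mem_image2, Set.mem_ofPred_eq]
    constructor
    · rintro ⟨hR, hfit⟩
      rcases hR.exists_empty_column rfl with hn | ⟨Q, P, rfl, hQ, hn, hP⟩
      · exact Or.inl ⟨hR, hfit, hn⟩
      · rw [hsep Q P hQ, not_or] at hfit
        exact Or.inr ⟨Q, ⟨hQ, hfit.1, hn⟩, P, ⟨hP, hfit.2⟩, rfl⟩
    · rintro (⟨hR, hfit, -⟩ | ⟨Q, ⟨hQ, hfit', hn⟩, P, ⟨hP, hfit⟩, rfl⟩)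
      · exact ⟨hR, hfit⟩
      · rw [hsep Q P hQ, not_or]
        refine ⟨?_, hfit', hfit⟩
        have h₁ : GoodFrom 0 ((false, false) :: P) := ⟨le_rfl, by simpa [sgn] using hP⟩
        have h₂ := (hQ.append_iff (R := (false, false) :: P) (t := 0) le_rfl).2 h₁
        rwa [add_zero] at h₂
  have hset' : {P | GoodFrom 0 P ∧ ¬ Fits A B k 0 P ∧ NoEmptyColumn 0 P} = {[]} ∪
      {P | GoodFrom 0 P ∧ ¬ Fits A B k 0 P ∧ P ≠ [] ∧ NoEmptyColumn 0 P} := by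
    ext P
    simp only [Set.mem_union, Set.mem_ofPred_eq, Set.mem_singleton_iff]
    rcases eq_or_ne P [] with rfl | hP
    · exact iff_of_true ⟨rfl, not_fits_nil hk _, trivial⟩ (Or.inl rfl)
    · simp [hP]
  have hT : listGenFun {P | GoodFrom 0 P ∧ ¬ Fits A B k 0 P ∧ NoEmptyColumn 0 P} =
      1 + listGenFun {P | GoodFrom 0 P ∧ ¬ Fits A B k 0 P ∧ P ≠ [] ∧ NoEmptyColumn 0 P} := by
    rw [hset', listGenFun_union, listGenFun_nil]
    rw [Set.disjoint_left]
    rintro _ rfl ⟨-, -, h, -⟩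
    exact h rfl
  conv_lhs => rw [hset]
  rw [listGenFun_union, listGenFun_image2 1, hT]
  · ring
  · intro P _ Q _
    simp
    omega
  · rintro Q ⟨hQ, -, hn⟩ P - Q' ⟨hQ', -, hn'⟩ P' - h
    exact GoodFrom.empty_column_unique hQ hQ' hn hn' h
  · rw [Set.disjoint_left]
    rintro _ ⟨-, -, hn⟩ ⟨Q, ⟨hQ, -⟩, P, -, rfl⟩
    exact hQ.not_noEmptyColumn_append hn

end HeapPattern

theorem theorem3 (k : ℕ) (hk : 1 ≤ k)
    (h : Equiv.Perm (Fin (k + 2 + 1))) (g : Equiv.Perm (Fin (k + 1)))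
    (hconn : HeapPattern.Connected h)
    (hfc : HeapPattern.FullyCommutative h)
    (htwo : HeapPattern.TwoInInternalColumns h)
    (hg : HeapPattern.IsDiamondReduction h g) :
    HeapPattern.genFun h =
        (1 - PowerSeries.X - PowerSeries.X * HeapPattern.genFunConnected g) *
          (1 - 3 * PowerSeries.X + PowerSeries.X ^ 2 +
            (PowerSeries.X ^ 2 - PowerSeries.X) * HeapPattern.genFunConnected g)⁻¹ ∧
      HeapPattern.genFun h =
        (1 - 2 * PowerSeries.X - PowerSeries.X ^ 2 * HeapPattern.genFun g)⁻¹ := by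
  open HeapPattern in
  obtain ⟨hg321, hne, -⟩ := exists_shift_of_isDiamondReduction hk hfc.avoids321 htwo hg
  have hF : genFun h = listGenFun (avoidingPaths (lower (steps g)) (upper (steps g)) k (-2)) := by
    ext n
    simp only [genFun, listGenFun, PowerSeries.coeff_mk]
    rw [card_avoids321_eq (HeapAvoids · h)
      (fun P => ¬ Fits (lower (steps g)) (upper (steps g)) k (-2) P) fun w hw => not_congr
        (heapContains_iff_fits_of_isDiamondReduction hk hw hconn hfc htwo hg)]
    rfl
  have hG : genFun g = listGenFun (avoidingPaths (lower (steps g)) (upper (steps g)) k 0) := by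
    ext n
    simp only [genFun, listGenFun, PowerSeries.coeff_mk]
    rw [card_avoids321_eq (HeapAvoids · g)
      (fun P => ¬ Fits (lower (steps g)) (upper (steps g)) k 0 P) fun w hw => not_congr
        (heapContains_iff_fits hw hg321 hk hne)]
    rfl
  have hC : genFunConnected g = listGenFun {P | GoodFrom 0 P ∧
      ¬ Fits (lower (steps g)) (upper (steps g)) k 0 P ∧ P ≠ [] ∧ NoEmptyColumn 0 P} := by
    ext n
    simp only [genFunConnected, listGenFun, PowerSeries.coeff_mk]
    rw [card_avoids321_eq]
    intro w hw
    refine and_congr (not_congr (heapContains_iff_fits hw hg321 hk hne)) ?_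
    rw [connected_iff hw, noEmptyColumn_iff, length_steps, ← List.length_pos_iff, length_steps]
    simp only [add_zero]
  have h₁ := listGenFun_avoidingPaths_neg_two hk hne
  have h₂ := listGenFun_avoidingPaths_zero hk hne
  rw [← hF, ← hG] at h₁
  rw [← hG, ← hC] at h₂
  constructor
  · rw [PowerSeries.eq_mul_inv_iff_mul_eq (by simp)]
    linear_combination (1 - PowerSeries.X - PowerSeries.X * genFunConnected g) * h₁ +
      genFun h * PowerSeries.X ^ 2 * h₂
  · rw [PowerSeries.eq_inv_iff_mul_eq_one (by simp)]
    linear_combination h₁
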